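/- All sets are sets of strings over $\{0,1\}$, and $\chi_B$ denotes the characteristic function of $B$. A function $f$ is in $\mathrm{NPSV}_{\mathrm t}$ if there is a nondeterministic polynomial-time Turing machine $N$ such that on each input $x$ at least one computation path of $N(x)$ is an accepting path that outputs $f(x)$, and every accepting path of $N(x)$ outputs $f(x)$. A set $A$ is 1-truth-table strong nondeterministic reducible to $B$, written $A \le^{\mathcal{SN}}_{1\text{-}tt} B$, if there is a function in $\mathrm{NPSV}_{\mathrm t}$ that computes, on each input $x$, a string $y$ and a predicate $\alpha$ of one Boolean variable such that $x \in A \iff \alpha(\chi_B(y))$. For a class $\mathcal C$ let $\mathrm{R}^{\mathcal{SN}}_{1\text{-}tt}(\mathcal C) = \{L \mid (\exists B \in \mathcal C)[L \le^{\mathcal{SN}}_{1\text{-}tt} B]\}$. For classes $\mathcal C$ and $\mathcal D$, let $\mathrm{P}^{\mathcal C:\mathcal D}$ be the class of languages accepted by a deterministic polynomial-time oracle Turing machine that makes (at most) one query to a set $A \in \mathcal C$ followed by (at most) one query to a set $B \in \mathcal D$, and let $\mathrm{P}^{(\mathcal C,\mathcal D)}$ be the class of languages accepted by a deterministic polynomial-time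 oracle Turing machine that makes (at most once), simultaneously, one query to a set $A \in \mathcal C$ and one query to a set $B \in \mathcal D$. The polynomial time bounds of oracle machines do not depend on the oracles. Corollary. $$\mathrm{R}^{\mathcal{SN}}_{1\text{-}tt}(\mathrm{NP}) = \mathrm{P}^{\mathrm{NP}\cap\mathrm{coNP}:\mathrm{NP}} = \mathrm{P}^{\mathrm{NP}:\mathrm{NP}\cap\mathrm{coNP}} = \mathrm{P}^{(\mathrm{NP}\cap\mathrm{coNP},\,\mathrm{NP})}.$$ -/

import Mathlib

namespace SNQuery

/-- Strings over the alphabet `{0,1}`. -/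
abbrev Word := List Bool

/-- Tape symbols: the bits, and `none` for the blank.  The number of tapes of a machine is
arbitrary, so a tape over a larger finite alphabet is available as several binary tapes whose
heads move together, without any loss of time. -/
abbrev Sym := Option Bool

/-- The bits at the front of a list of symbols, up to the first blank. -/
def leadingBits : List Sym → Word
  | some b :: l => b :: leadingBits l
  | _ => []

theorem leadingBits_append_blanks (l : List Sym) (n : ℕ) :
    leadingBits (l ++ List.replicate n default) = leadingBits l := by
  induction l with
  | nil => cases n <;> rfl
  | cons a l ih => cases a with
    | none => rfl
    | some b => simp only [List.cons_append, leadingBits, ih]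

/-- The word written on a tape: the bits from the scanned cell (included) to the right, up to
the first blank. -/
def tapeWord (T : Turing.Tape Sym) : Word :=
  T.right₀.liftOn leadingBits (by
    rintro a b ⟨n, rfl⟩
    exact (leadingBits_append_blanks a n).symm)

/-- A configuration of a machine with states `Q` and (two-way infinite) tapes indexed
by `K`. -/
@[ext] structure Cfg (Q K : Type) where
  state : Q
  tape : K → Turing.Tape Sym

/-- The symbols under the heads. -/
def Cfg.scan {Q K : Type} (c : Cfg Q K) : K → Sym := fun k => (c.tape k).head

/-- What one step does to a tape: write a symbol, then move the head by one cell in the given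
direction, where `none` means that the head stays. -/
abbrev Action := Sym × Option Turing.Dir

/-- The effect of an action on a tape. -/
def Action.apply (a : Action) (T : Turing.Tape Sym) : Turing.Tape Sym :=
  match a.2 with
  | none => T.write a.1
  | some d => (T.write a.1).move d

/-- Enter state `q` and perform one action on each tape. -/
def Cfg.next {Q K : Type} (c : Cfg Q K) (q : Q) (act : K → Action) : Cfg Q K where
  state := q
  tape := fun k => (act k).apply (c.tape k)

open Classical in
/-- Initial configuration: `x` stands on the input tape, with the head on its first symbol,
and all other tapes are blank. -/
noncomputable def Cfg.initial {Q K : Type} (start : Q) (inp : K) (x : Word) : Cfg Q K where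
  state := start
  tape := fun k => if k = inp then Turing.Tape.mk₁ (x.map some) else Turing.Tape.mk₁ []

/-! ### Nondeterministic machines, `NP`, `coNP` and `NPSV_t` -/

/-- A nondeterministic multi-tape Turing machine (acceptor or transducer).  A state `q` with
`verdict q = some true` is accepting, one with `verdict q = some false` is rejecting, and the
computation goes on in the other states, where `δ` lists the possible moves. -/
structure NTM where
  Q : Type
  K : Type
  [finQ : Finite Q]
  [finK : Finite K]
  start : Q
  inp : K
  out : K
  verdict : Q → Option Bool
  δ : Q → (K → Sym) → Set (Q × (K → Action))

namespace NTM

variable (N : NTM)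

/-- The initial configuration on input `x`. -/
noncomputable def init (x : Word) : Cfg N.Q N.K := Cfg.initial N.start N.inp x

/-- `c'` is a possible successor of `c`. -/
def Step (c c' : Cfg N.Q N.K) : Prop :=
  N.verdict c.state = none ∧ ∃ m ∈ N.δ c.state c.scan, c' = c.next m.1 m.2

/-- `N.Path n c c'`: some computation path of exactly `n` steps leads from `c` to `c'`. -/
inductive Path : ℕ → Cfg N.Q N.K → Cfg N.Q N.K → Prop
  | refl (c : Cfg N.Q N.K) : Path 0 c c
  | head {n : ℕ} {c d e : Cfg N.Q N.K} (h : N.Step c d) (t : Path n d e) : Path (n + 1) c e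

/-- Every computation path is polynomially bounded in the length of the input. -/
def PolyTime : Prop :=
  ∃ p : Polynomial ℕ, ∀ (x : Word) (n : ℕ) (c : Cfg N.Q N.K),
    N.Path n (N.init x) c → n ≤ p.eval x.length

/-- Some accepting computation path on input `x` ends in the configuration `c`. -/
def AcceptsAt (x : Word) (c : Cfg N.Q N.K) : Prop :=
  (∃ n, N.Path n (N.init x) c) ∧ N.verdict c.state = some true

/-- Some computation path on input `x` accepts. -/
def Accepts (x : Word) : Prop := ∃ c, N.AcceptsAt x c

/-- Some accepting computation path on input `x` outputs `y`. -/
def Outputs (x y : Word) : Prop := ∃ c, N.AcceptsAt x c ∧ tapeWord (c.tape N.out) = y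

end NTM

/-- The class `NP`. -/
def NP : Set (Set Word) :=
  {L | ∃ N : NTM, N.PolyTime ∧ ∀ x, x ∈ L ↔ N.Accepts x}

/-- The class `coNP`. -/
def coNP : Set (Set Word) := {L | Lᶜ ∈ NP}

/-- The class `NPSV_t` of total single-valued nondeterministic polynomial-time functions:
on each input `x` some accepting path outputs `f x`, and every accepting path outputs `f x`. -/
def NPSVt : Set (Word → Word) :=
  {f | ∃ N : NTM, N.PolyTime ∧ ∀ x, N.Outputs x (f x) ∧ ∀ y, N.Outputs x y → y = f x}

open Classical in
/-- The characteristic function of a set of strings. -/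
noncomputable def chi (A : Set Word) (x : Word) : Bool := decide (x ∈ A)

/-- The pair of a predicate `α` of one Boolean variable (given by its truth table) and a
string `y`, as one string. -/
def encodeTT (α : Bool → Bool) (y : Word) : Word := α false :: α true :: y

/-- `A` is 1-truth-table strong nondeterministic reducible to `B`: a function in `NPSV_t`
computes a string `y x` and a predicate `α x` of one Boolean variable such that
`x ∈ A` iff `α x (χ_B (y x))` holds. -/
def ReducesSN1tt (A B : Set Word) : Prop :=
  ∃ (y : Word → Word) (α : Word → Bool → Bool),
    (fun x => encodeTT (α x) (y x)) ∈ NPSVt ∧ ∀ x, x ∈ A ↔ α x (chi B (y x)) = true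

/-- The closure of the class `C` under 1-truth-table strong nondeterministic reductions. -/
def RSN1tt (C : Set (Set Word)) : Set (Set Word) := {L | ∃ B ∈ C, ReducesSN1tt L B}

/-! ### Deterministic machines with two oracles -/

/-- What a deterministic oracle machine does in a state: make an ordinary step that depends on
the scanned symbols, ask the first oracle about the word on the first query tape, ask the
second oracle about the word on the second query tape, do both simultaneously, or halt.
An answer determines the next state and leaves the tapes unchanged. -/
inductive Instr (Q K : Type) where
  | compute (δ : (K → Sym) → Q × (K → Action))
  | askFst (next : Bool → Q)
  | askSnd (next : Bool → Q)
  | askBoth (next : Bool → Bool → Q)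
  | halt (accept : Bool)

/-- The kinds of oracle queries. -/
inductive Query where
  | fst
  | snd
  | both

/-- The kind of query that an instruction makes, if any. -/
def Instr.query {Q K : Type} : Instr Q K → Option Query
  | .askFst _ => some .fst
  | .askSnd _ => some .snd
  | .askBoth _ => some .both
  | _ => none

/-- A deterministic multi-tape Turing machine with two oracles. -/
structure OTM where
  Q : Type
  K : Type
  [finQ : Finite Q]
  [finK : Finite K]
  start : Q
  inp : K
  qryFst : K
  qrySnd : K
  instr : Q → Instr Q K

namespace OTM

variable (M : OTM)

/-- The initial configuration on input `x`. -/
noncomputable def init (x : Word) : Cfg M.Q M.K := Cfg.initial M.start M.inp x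

/-- One step with oracles `A` and `B`.  A halted configuration does not change. -/
noncomputable def step (A B : Set Word) (c : Cfg M.Q M.K) : Cfg M.Q M.K :=
  match M.instr c.state with
  | .compute δ => c.next (δ c.scan).1 (δ c.scan).2
  | .askFst next => ⟨next (chi A (tapeWord (c.tape M.qryFst))), c.tape⟩
  | .askSnd next => ⟨next (chi B (tapeWord (c.tape M.qrySnd))), c.tape⟩
  | .askBoth next =>
      ⟨next (chi A (tapeWord (c.tape M.qryFst))) (chi B (tapeWord (c.tape M.qrySnd))), c.tape⟩
  | .halt _ => c

/-- The configuration after `n` steps on input `x` with oracles `A` and `B`. -/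
noncomputable def run (A B : Set Word) (x : Word) (n : ℕ) : Cfg M.Q M.K :=
  (M.step A B)^[n] (M.init x)

/-- The machine runs in polynomial time, with a time bound that does not depend on the
oracles. -/
def PolyTime : Prop :=
  ∃ p : Polynomial ℕ, ∀ (A B : Set Word) (x : Word),
    ∃ b, M.instr (M.run A B x (p.eval x.length)).state = .halt b

/-- The machine accepts `x` with oracles `A` and `B`. -/
def Accepts (A B : Set Word) (x : Word) : Prop :=
  ∃ n, M.instr (M.run A B x n).state = .halt true

/-- The kinds of the queries made in the first `n` steps, in chronological order. -/
noncomputable def queries (A B : Set Word) (x : Word) (n : ℕ) : List Query :=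
  (List.range n).filterMap fun i => (M.instr (M.run A B x i).state).query

/-- On every input, with oracles `A` and `B`, the machine makes at most one query to `A`,
followed by at most one query to `B`, and no other query. -/
def SequentialQueries (A B : Set Word) : Prop :=
  ∀ x n, (M.queries A B x n).Sublist [.fst, .snd]

/-- On every input, with oracles `A` and `B`, the machine makes at most one simultaneous pair
of queries, one to `A` and one to `B`, and no other query. -/
def ParallelQueries (A B : Set Word) : Prop :=
  ∀ x n, (M.queries A B x n).Sublist [.both]

end OTM

/-- The class `P^{C:D}`: one query to a set in `C` followed by one query to a set in `D`. -/
def PSeq (C D : Set (Set Word)) : Set (Set Word) :=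
  {L | ∃ A ∈ C, ∃ B ∈ D, ∃ M : OTM,
    M.PolyTime ∧ M.SequentialQueries A B ∧ ∀ x, x ∈ L ↔ M.Accepts A B x}

/-- The class `P^{(C,D)}`: one query to a set in `C` made simultaneously with one query to a
set in `D`. -/
def PPar (C D : Set (Set Word)) : Set (Set Word) :=
  {L | ∃ A ∈ C, ∃ B ∈ D, ∃ M : OTM,
    M.PolyTime ∧ M.ParallelQueries A B ∧ ∀ x, x ∈ L ↔ M.Accepts A B x}

end SNQuery

/-!
All four classes are equal to `XorClass`, the class of the symmetric differences `A ∆ B` with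
`A ∈ NP ∩ coNP` and `B ∈ NP`.

A symmetric difference is decided by asking both oracles about the input, in either order or at
the same time (`symmDiff_mem_PSeq`, `symmDiff_mem_PPar`).  For the reduction of `A ∆ B` to `B`, a
nondeterministic machine guesses the bit `b = χ_A(x)` together with a proof that it is right, which
is possible since `A ∈ NP ∩ coNP`, and outputs the query `x` with the truth table `t ↦ b xor t`
(`xorClass_subset_RSN1tt_NP`).  Conversely, if a reduction computes `α` and `y` on input `x`, then
`α (χ_B y)` is the exclusive or of `α false`, a predicate in `NP ∩ coNP`, and of the condition that
`α false ≠ α true` and `y ∈ B`, which is in `NP` (`RSN1tt_NP_subset_xorClass`).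

For a machine with two oracles `A ∈ NP ∩ coNP` and `B ∈ NP` only one property of the queries
matters: each oracle is asked at most once (`OTM.OneQueryEach`).  Fix the answer `b` of the second
oracle.  The only query to `A` can be found by running the machine with constant answers, and an
`NP` machine can guess and verify the answer to it, so that the set `acceptedWith A b` of the inputs
accepted with second answer `b` belongs to `NP ∩ coNP`.  Likewise the set `sndYes A B` of the inputs
for which the right second answer is `true` belongs to `NP`.  The accepted set differs from
`acceptedWith A false` exactly on the inputs in `sndYes A B` that separate `acceptedWith A false`
from `acceptedWith A true` (`OTM.accepted_mem_xorClass`).  If the set in `NP` is asked first, the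
two oracles are exchanged (`OTM.swap`).

On the level of machines this needs the closure of `NP` under preimages by nondeterministically
computable functions, intersections and unions.  The first comes from a machine that runs `T`,
copies its output to a fresh tape and runs `N` there (`NTM.call`).  The analysis of composite
machines rests on `NTM.Embeds`: as long as a part of a machine is running, its computation paths are
those of the part.
-/

namespace SNQuery

open Turing

attribute [instance] NTM.finQ NTM.finK OTM.finQ OTM.finK

/-! ### Words on tapes -/

@[simp] theorem tapeWord_mk' (L : ListBlank Sym) (l : List Sym) :
    tapeWord (Tape.mk' L (ListBlank.mk l)) = leadingBits l := by
  rw [tapeWord, Tape.mk'_right₀]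
  rfl

@[simp] theorem leadingBits_map_some (w : Word) : leadingBits (w.map some) = w := by
  induction w with
  | nil => rfl
  | cons b w ih => simp [leadingBits, ih]

@[simp] theorem tapeWord_mk₁ (w : Word) : tapeWord (Tape.mk₁ (w.map some)) = w := by
  simp [Tape.mk₁, Tape.mk₂]

theorem head_of_tapeWord_nil {T : Tape Sym} (h : tapeWord T = []) : T.head = none := by
  obtain ⟨L, R, rfl⟩ := T.exists_mk'
  induction R using ListBlank.induction_on with | _ l =>
  rcases l with - | ⟨- | b, l⟩
  · rfl
  · rfl
  · simp [leadingBits] at h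

theorem head_of_tapeWord_cons {T : Tape Sym} {b : Bool} {w : Word} (h : tapeWord T = b :: w) :
    T.head = some b ∧ tapeWord (T.move Dir.right) = w := by
  obtain ⟨L, R, rfl⟩ := T.exists_mk'
  induction R using ListBlank.induction_on with | _ l =>
  rcases l with - | ⟨- | a, l⟩
  · simp [leadingBits] at h
  · simp [leadingBits] at h
  · simp only [tapeWord_mk', leadingBits, List.cons.injEq] at h
    obtain ⟨rfl, rfl⟩ := h
    simp

/-- All but at most `m` cells of the tape are blank, the scanned cell being counted among
the `m`; the lists cover the part of the tape that has been visited or written. -/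
def TapeBound (T : Tape Sym) (m : ℕ) : Prop :=
  ∃ (a : Sym) (l r : List Sym), T = ⟨a, ListBlank.mk l, ListBlank.mk r⟩ ∧
    l.length + r.length + 1 ≤ m

theorem TapeBound.mono {T : Tape Sym} {m n : ℕ} (h : TapeBound T m) (hmn : m ≤ n) :
    TapeBound T n := by
  obtain ⟨a, l, r, e, hl⟩ := h
  exact ⟨a, l, r, e, hl.trans hmn⟩

theorem TapeBound.apply {T : Tape Sym} {m : ℕ} (h : TapeBound T m) (act : Action) :
    TapeBound (act.apply T) (m + 1) := by
  obtain ⟨a, l, r, rfl, hl⟩ := h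
  obtain ⟨s, - | - | -⟩ := act
  · exact ⟨s, l, r, rfl, by omega⟩
  · refine ⟨l.headI, l.tail, s :: r, rfl, ?_⟩
    simp only [List.length_tail, List.length_cons]
    omega
  · refine ⟨r.headI, s :: l, r.tail, rfl, ?_⟩
    simp only [List.length_tail, List.length_cons]
    omega

theorem length_leadingBits_le (l : List Sym) : (leadingBits l).length ≤ l.length := by
  induction l with
  | nil => simp [leadingBits]
  | cons a l ih => cases a <;> simp [leadingBits, ih]

theorem TapeBound.length_tapeWord_le {T : Tape Sym} {m : ℕ} (h : TapeBound T m) :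
    (tapeWord T).length ≤ m := by
  obtain ⟨a, l, r, rfl, hl⟩ := h
  have : tapeWord ⟨a, ListBlank.mk l, ListBlank.mk r⟩ = leadingBits (a :: r) := rfl
  rw [this]
  refine (length_leadingBits_le _).trans ?_
  simp only [List.length_cons]
  omega

theorem tapeBound_mk₁ (l : List Sym) : TapeBound (Tape.mk₁ l) (l.length + 1) := by
  refine ⟨l.headI, [], l.tail, rfl, ?_⟩
  simp

theorem tapeBound_initial {Q K : Type} (q : Q) (i : K) (x : Word) (k : K) :
    TapeBound ((Cfg.initial q i x).tape k) (x.length + 1) := by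
  unfold Cfg.initial
  dsimp only
  split
  · simpa using tapeBound_mk₁ (x.map some)
  · exact (tapeBound_mk₁ []).mono (by simp)

theorem apply_stay (T : Tape Sym) : Action.apply (T.head, none) T = T := by
  simp [Action.apply]

/-! ### Computation paths -/

namespace NTM

variable (N : NTM)

/-- Some computation path from `c` ends in the accepting configuration `e`. -/
def AccFrom (c e : Cfg N.Q N.K) : Prop :=
  (∃ n, N.Path n c e) ∧ N.verdict e.state = some true

/-- All computation paths from `c` have length at most `B`. -/
def TimeFrom (c : Cfg N.Q N.K) (B : ℕ) : Prop := ∀ n e, N.Path n c e → n ≤ B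

/-- Some computation path from `c` ends in the halting configuration `e`. -/
def HaltsAt (c e : Cfg N.Q N.K) : Prop :=
  (∃ n, N.Path n c e) ∧ N.verdict e.state ≠ none

variable {N}

theorem path_zero_iff {c d : Cfg N.Q N.K} : N.Path 0 c d ↔ d = c :=
  ⟨fun h => by cases h; rfl, fun h => h ▸ .refl _⟩

theorem path_succ_iff {n : ℕ} {c e : Cfg N.Q N.K} :
    N.Path (n + 1) c e ↔ ∃ d, N.Step c d ∧ N.Path n d e :=
  ⟨fun h => by cases h with | head hs hp => exact ⟨_, hs, hp⟩, fun ⟨_, hs, hp⟩ => .head hs hp⟩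

theorem accFrom_iff_of_none {c e : Cfg N.Q N.K} (hc : N.verdict c.state = none) :
    N.AccFrom c e ↔ ∃ d, N.Step c d ∧ N.AccFrom d e := by
  constructor
  · rintro ⟨⟨n, h⟩, he⟩
    cases h with
    | refl => simp [hc] at he
    | head h t => exact ⟨_, h, ⟨_, t⟩, he⟩
  · rintro ⟨d, h, ⟨n, t⟩, he⟩
    exact ⟨⟨_, .head h t⟩, he⟩

theorem accFrom_iff_of_ne_none {c e : Cfg N.Q N.K} (hc : N.verdict c.state ≠ none) :
    N.AccFrom c e ↔ e = c ∧ N.verdict c.state = some true := by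
  constructor
  · rintro ⟨⟨n, h⟩, he⟩
    cases h with
    | refl => exact ⟨rfl, he⟩
    | head h t => exact absurd h.1 hc
  · rintro ⟨rfl, he⟩
    exact ⟨⟨0, .refl _⟩, he⟩

theorem timeFrom_zero {c : Cfg N.Q N.K} (hc : N.verdict c.state ≠ none) : N.TimeFrom c 0 := by
  intro n e h
  cases h with
  | refl => rfl
  | head h t => exact absurd h.1 hc

theorem timeFrom_succ {c : Cfg N.Q N.K} {B : ℕ} (h : ∀ d, N.Step c d → N.TimeFrom d B) :
    N.TimeFrom c (B + 1) := by
  intro _ _ hp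
  cases hp with
  | refl => omega
  | head hs t => exact Nat.succ_le_succ (h _ hs _ _ t)

theorem TimeFrom.mono {c : Cfg N.Q N.K} {B B' : ℕ} (h : N.TimeFrom c B) (hB : B ≤ B') :
    N.TimeFrom c B' := fun n e hp => (h n e hp).trans hB

theorem TimeFrom.step {c d : Cfg N.Q N.K} {B : ℕ} (h : N.TimeFrom c (B + 1)) (hs : N.Step c d) :
    N.TimeFrom d B := fun _ e hp => Nat.succ_le_succ_iff.1 (h _ e (.head hs hp))

theorem TimeFrom.one_le {c d : Cfg N.Q N.K} {B : ℕ} (h : N.TimeFrom c B) (hs : N.Step c d) :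
    1 ≤ B := h 1 d (.head hs (.refl _))

/-- The tapes grow by at most one cell per step. -/
theorem Path.tapeBound {n : ℕ} {c e : Cfg N.Q N.K} (h : N.Path n c e) {k : N.K} {m : ℕ}
    (hb : TapeBound (c.tape k) m) : TapeBound (e.tape k) (m + n) := by
  induction h generalizing m with
  | refl => exact hb
  | head h t ih =>
    obtain ⟨-, a, -, rfl⟩ := h
    have := ih (hb.apply (a.2 k))
    rwa [Nat.add_assoc, Nat.add_comm 1] at this

variable (N) in
/-- From `c` the machine has no choice until it has reached `d`, after `k` steps. -/
def DetReach (k : ℕ) (c d : Cfg N.Q N.K) : Prop :=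
  (∀ e, N.AccFrom c e ↔ N.AccFrom d e) ∧ ∀ B, N.TimeFrom d B → N.TimeFrom c (B + k)

theorem DetReach.trans {k l : ℕ} {c d e : Cfg N.Q N.K} (h : N.DetReach k c d)
    (h' : N.DetReach l d e) : N.DetReach (k + l) c e := by
  refine ⟨fun f => (h.1 f).trans (h'.1 f), fun B hB => ?_⟩
  have := h.2 _ (h'.2 _ hB)
  rwa [Nat.add_assoc, Nat.add_comm l] at this

theorem DetReach.of_δ {c d : Cfg N.Q N.K} {q : N.Q} {act : N.K → Action}
    (hc : N.verdict c.state = none) (hδ : N.δ c.state c.scan = {(q, act)})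
    (hd : c.next q act = d) : N.DetReach 1 c d := by
  subst hd
  have key : ∀ d, N.Step c d ↔ d = c.next q act := by
    intro d
    simp [Step, hc, hδ]
  refine ⟨fun e => ?_, fun B hB => timeFrom_succ fun d hd => ?_⟩
  · rw [accFrom_iff_of_none hc]
    simp [key]
  · rw [key] at hd
    rwa [hd]

/-! ### Running one machine inside another -/

/-- The action on all tapes that is `act` on the tapes in the range of `j` and does nothing on the
other tapes, on which the symbols `scan` are being read. -/
noncomputable def liftAct {K K' : Type} (j : K → K') (scan : K' → Sym) (act : K → Action) :
    K' → Action :=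
  Function.extend j act fun k => (scan k, none)

/-- `d` as a part of a configuration of a larger machine, via the maps `s` of states and `j` of
tapes; the other tapes are taken from `t`. -/
noncomputable def liftCfg {Q Q' K K' : Type} (s : Q → Q') (j : K → K') (t : K' → Tape Sym)
    (d : Cfg Q K) : Cfg Q' K' := ⟨s d.state, Function.extend j d.tape t⟩

/-- The machine `M` behaves like `N` in the states `s q` where `N` goes on in state `q`; the tapes
of `N` are embedded into those of `M` by `j`. -/
structure Embeds (N M : NTM) (s : N.Q → M.Q) (j : N.K → M.K) : Prop where
  injective : Function.Injective j
  verdict : ∀ q, N.verdict q = none → M.verdict (s q) = none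
  δ : ∀ q scan, N.verdict q = none →
    M.δ (s q) scan = (fun m => (s m.1, liftAct j scan m.2)) '' N.δ q (scan ∘ j)

namespace Embeds

variable {M : NTM} {s : N.Q → M.Q} {j : N.K → M.K}

theorem next_liftCfg (hj : Function.Injective j) (t : M.K → Tape Sym) (d : Cfg N.Q N.K) (q : N.Q)
    (act : N.K → Action) :
    (liftCfg s j t d).next (s q) (liftAct j (liftCfg s j t d).scan act) =
      liftCfg s j t (d.next q act) := by
  refine Cfg.ext rfl (funext fun k => ?_)
  by_cases hk : ∃ i, j i = k
  · obtain ⟨i, rfl⟩ := hk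
    simp [liftCfg, liftAct, Cfg.next, hj.extend_apply]
  · simp only [liftCfg, liftAct, Cfg.next, Cfg.scan, Function.extend_apply' _ _ _ hk]
    exact apply_stay _

theorem step_iff (h : Embeds N M s j) {t : M.K → Tape Sym} {d : Cfg N.Q N.K} {e : Cfg M.Q M.K}
    (hd : N.verdict d.state = none) :
    M.Step (liftCfg s j t d) e ↔ ∃ d', N.Step d d' ∧ e = liftCfg s j t d' := by
  have hscan : (liftCfg s j t d).scan ∘ j = d.scan := by
    funext i
    simp [liftCfg, Cfg.scan, h.injective.extend_apply]
  have hδ := h.δ d.state (liftCfg s j t d).scan hd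
  rw [hscan] at hδ
  have hs : (liftCfg s j t d).state = s d.state := rfl
  simp only [Step, hs, h.verdict _ hd, hδ, hd, true_and, Set.exists_mem_image, next_liftCfg
    h.injective]
  constructor
  · rintro ⟨m, hm, rfl⟩
    exact ⟨_, ⟨m, hm, rfl⟩, rfl⟩
  · rintro ⟨_, ⟨m, hm, rfl⟩, rfl⟩
    exact ⟨m, hm, rfl⟩

theorem accFrom_of_path (h : Embeds N M s j) {t : M.K → Tape Sym} {n : ℕ} {d d' : Cfg N.Q N.K}
    {e : Cfg M.Q M.K} (hp : N.Path n d d') (he : M.AccFrom (liftCfg s j t d') e) :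
    M.AccFrom (liftCfg s j t d) e := by
  induction hp with
  | refl => exact he
  | head hs _ ih =>
    rw [accFrom_iff_of_none (h.verdict _ hs.1)]
    exact ⟨_, (h.step_iff hs.1).2 ⟨_, hs, rfl⟩, ih he⟩

theorem exists_haltsAt (h : Embeds N M s j) {t : M.K → Tape Sym} {n : ℕ} {d : Cfg N.Q N.K}
    {e : Cfg M.Q M.K} (hp : M.Path n (liftCfg s j t d) e) (he : M.verdict e.state = some true) :
    ∃ d', N.HaltsAt d d' ∧ M.AccFrom (liftCfg s j t d') e := by
  induction n generalizing d with
  | zero =>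
    cases hp
    refine ⟨d, ⟨⟨0, .refl _⟩, fun hd => ?_⟩, ⟨0, .refl _⟩, he⟩
    have := h.verdict _ hd
    simp [liftCfg, this] at he
  | succ n ih =>
    by_cases hd : N.verdict d.state = none
    · cases hp with
      | head hs hp =>
        obtain ⟨d₁, hs₁, rfl⟩ := (h.step_iff hd).1 hs
        obtain ⟨d', ⟨⟨m, hm⟩, hv⟩, ha⟩ := ih hp
        exact ⟨d', ⟨⟨_, .head hs₁ hm⟩, hv⟩, ha⟩
    · exact ⟨d, ⟨⟨0, .refl _⟩, hd⟩, ⟨_, hp⟩, he⟩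

/-- The accepting paths from a configuration in which the part `N` is running are those that lead
`N` to a halting configuration and go on from there. -/
theorem accFrom_iff (h : Embeds N M s j) {t : M.K → Tape Sym} {d : Cfg N.Q N.K}
    {e : Cfg M.Q M.K} :
    M.AccFrom (liftCfg s j t d) e ↔ ∃ d', N.HaltsAt d d' ∧ M.AccFrom (liftCfg s j t d') e :=
  ⟨fun ⟨⟨_, hp⟩, he⟩ => h.exists_haltsAt hp he,
    fun ⟨_, ⟨⟨_, hp⟩, _⟩, he⟩ => h.accFrom_of_path hp he⟩

theorem timeFrom (h : Embeds N M s j) {t : M.K → Tape Sym} {d : Cfg N.Q N.K} {B B' : ℕ}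
    (hB : N.TimeFrom d B)
    (hB' : ∀ d', N.HaltsAt d d' → M.TimeFrom (liftCfg s j t d') B') :
    M.TimeFrom (liftCfg s j t d) (B + B') := by
  induction B generalizing d with
  | zero =>
    by_cases hd : N.verdict d.state = none
    · intro n e hp
      cases hp with
      | refl => omega
      | head hs hp =>
        obtain ⟨d₁, hs₁, rfl⟩ := (h.step_iff hd).1 hs
        exact absurd (hB.one_le hs₁) (by omega)
    · exact (hB' d ⟨⟨0, .refl _⟩, hd⟩).mono (by omega)
  | succ B ih =>
    by_cases hd : N.verdict d.state = none
    · rw [Nat.add_right_comm]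
      refine timeFrom_succ fun e he => ?_
      obtain ⟨d₁, hs₁, rfl⟩ := (h.step_iff hd).1 he
      exact ih (hB.step hs₁) fun d' ⟨⟨m, hm⟩, hv⟩ => hB' d' ⟨⟨_, .head hs₁ hm⟩, hv⟩
    · exact (hB' d ⟨⟨0, .refl _⟩, hd⟩).mono (by omega)

end Embeds

theorem polyTime_iff : N.PolyTime ↔
    ∃ p : Polynomial ℕ, ∀ x, N.TimeFrom (N.init x) (p.eval x.length) := Iff.rfl

theorem acceptsAt_iff {x : Word} {c : Cfg N.Q N.K} : N.AcceptsAt x c ↔ N.AccFrom (N.init x) c :=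
  Iff.rfl

theorem HaltsAt.length_tapeWord_le {p : ℕ} {x : Word} {d : Cfg N.Q N.K}
    (hN : N.TimeFrom (N.init x) p) (h : N.HaltsAt (N.init x) d) (k : N.K) :
    (tapeWord (d.tape k)).length ≤ x.length + 1 + p := by
  obtain ⟨⟨n, hn⟩, -⟩ := h
  exact ((hn.tapeBound (tapeBound_initial _ _ x k)).length_tapeWord_le).trans
    (Nat.add_le_add_left (hN _ _ hn) _)

end NTM

/-! ### Subroutine calls -/

theorem eval_monotone (p : Polynomial ℕ) : Monotone fun n => p.eval n := by
  intro m n hmn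
  induction p using Polynomial.induction_on' with
  | add p q hp hq => simpa using Nat.add_le_add hp hq
  | monomial k a => simpa using Nat.mul_le_mul_left a (Nat.pow_le_pow_left hmn k)

/-- The all-blank tapes. -/
def blanks (K : Type) : K → Tape Sym := fun _ => Tape.mk₁ []

theorem extend_inl {α β γ : Type} (f : α → γ) (g : α ⊕ β → γ) :
    Function.extend Sum.inl f g = Sum.elim f (g ∘ Sum.inr) := by
  funext k
  rcases k with k | k
  · exact Sum.inl_injective.extend_apply _ _ _
  · exact Function.extend_apply' _ _ _ (by simp)

theorem extend_inr {α β γ : Type} (f : β → γ) (g : α ⊕ β → γ) :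
    Function.extend Sum.inr f g = Sum.elim (g ∘ Sum.inl) f := by
  funext k
  rcases k with k | k
  · exact Function.extend_apply' _ _ _ (by simp)
  · exact Sum.inr_injective.extend_apply _ _ _

open Classical in
theorem initial_tape {Q K : Type} (q : Q) (i : K) (x : Word) :
    (Cfg.initial q i x).tape = Function.update (blanks K) i (Tape.mk₁ (x.map some)) := by
  funext k
  by_cases h : k = i
  · subst h
    simp [Cfg.initial]
  · simp [Cfg.initial, h, blanks]

namespace NTM

/-- The two loops of `call`: copying to the right, and rewinding. -/
inductive CopyPhase where
  | copy
  | rewind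

instance : Finite CopyPhase :=
  Finite.of_surjective (fun b : Bool => if b then CopyPhase.copy else .rewind) fun
    | .copy => ⟨true, rfl⟩
    | .rewind => ⟨false, rfl⟩

open Classical in
/-- The actions of the loops of `call`: write `a` on the tape `i` of the second machine, and move
in the direction `dir` there and on the tape `o` of the first machine. -/
noncomputable def moveBoth {K K' : Type} (o : K) (i : K') (scan : K ⊕ K' → Sym) (a : Sym)
    (dir : Dir) : K ⊕ K' → Action :=
  Sum.elim (fun k => (scan (.inl k), if k = o then some dir else none))
    (fun k => if k = i then (a, some dir) else (scan (.inr k), none))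

/-- Run `T`; when it accepts, copy its output word to the input tape of `N`, move the heads back,
and run `N`.  The tapes of `T` are left as they were when `T` accepted, and `o` is the output tape
of the whole machine. -/
noncomputable def call (T N : NTM) (o : T.K ⊕ N.K) : NTM where
  Q := T.Q ⊕ CopyPhase ⊕ N.Q
  K := T.K ⊕ N.K
  start := .inl T.start
  inp := .inl T.inp
  out := o
  verdict
    | .inl q => if T.verdict q = some true then none else T.verdict q
    | .inr (.inl _) => none
    | .inr (.inr q) => N.verdict q
  δ
    | .inl q, scan =>
      if T.verdict q = some true then {(.inr (.inl .copy), fun k => (scan k, none))}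
      else (fun m => (.inl m.1, liftAct .inl scan m.2)) '' T.δ q (scan ∘ .inl)
    | .inr (.inl .copy), scan =>
      if scan (.inl T.out) = none then
        {(.inr (.inl .rewind), moveBoth T.out N.inp scan (scan (.inr N.inp)) .left)}
      else {(.inr (.inl .copy), moveBoth T.out N.inp scan (scan (.inl T.out)) .right)}
    | .inr (.inl .rewind), scan =>
      if scan (.inr N.inp) = none then
        {(.inr (.inr N.start), moveBoth T.out N.inp scan (scan (.inr N.inp)) .right)}
      else {(.inr (.inl .rewind), moveBoth T.out N.inp scan (scan (.inr N.inp)) .left)}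
    | .inr (.inr q), scan =>
      (fun m => (.inr (.inr m.1), liftAct .inr scan m.2)) '' N.δ q (scan ∘ .inr)

section Call

variable {T N : NTM} {o : T.K ⊕ N.K}

theorem call_embeds_fst : Embeds T (call T N o) Sum.inl Sum.inl where
  injective := Sum.inl_injective
  verdict q hq := by simp [call, hq]
  δ q scan hq := by simp [call, hq]

variable (T o) in
/-- The states of `call T N o` in which `N` is running. -/
def sndState (q : N.Q) : (call T N o).Q := .inr (.inr q)

theorem call_embeds_snd : Embeds N (call T N o) (sndState T o) Sum.inr where
  injective := Sum.inr_injective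
  verdict _ hq := hq
  δ _ _ _ := rfl

variable (N o) in
/-- The configuration of `call T N o` while `T` is running. -/
noncomputable abbrev fstCfg (d : Cfg T.Q T.K) : Cfg (call T N o).Q (call T N o).K :=
  liftCfg (Q' := (call T N o).Q) (K' := (call T N o).K) Sum.inl Sum.inl (blanks _) d

variable (T o) in
/-- The configuration of `call T N o` while `N` is running, when `t` are the tapes of `T`. -/
noncomputable abbrev sndCfg (t : T.K → Tape Sym) (d : Cfg N.Q N.K) :
    Cfg (call T N o).Q (call T N o).K :=
  liftCfg (K' := (call T N o).K) (sndState T o) Sum.inr (Sum.elim t (blanks N.K)) d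

theorem sndCfg_eq (t : T.K → Tape Sym) (d : Cfg N.Q N.K) :
    sndCfg T o t d = ⟨sndState T o d.state, Sum.elim t d.tape⟩ := by
  refine Cfg.ext rfl ?_
  exact (extend_inr _ _).trans rfl

theorem accFrom_sndCfg {t : T.K → Tape Sym} {d : Cfg N.Q N.K}
    {e : Cfg (call T N o).Q (call T N o).K} :
    (call T N o).AccFrom (sndCfg T o t d) e ↔
      ∃ d', N.HaltsAt d d' ∧ (call T N o).AccFrom (sndCfg T o t d') e :=
  call_embeds_snd.accFrom_iff

theorem fstCfg_tape (d : Cfg T.Q T.K) :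
    (fstCfg N o d).tape = Sum.elim d.tape (blanks N.K) := (extend_inl _ _).trans rfl

open Classical in
/-- The configurations of `call T N o` during the copying, when `t` are the tapes of `T`, with the
output tape replaced by `A`, and `B` is the input tape of `N`. -/
noncomputable def copyCfg (N : NTM) (o : T.K ⊕ N.K) (q : CopyPhase ⊕ N.Q) (t : T.K → Tape Sym)
    (A B : Tape Sym) : Cfg (call T N o).Q (call T N o).K :=
  ⟨.inr q, Sum.elim (Function.update t T.out A) (Function.update (blanks N.K) N.inp B)⟩

theorem copyCfg_next {q q' : CopyPhase ⊕ N.Q} {t : T.K → Tape Sym} {A B : Tape Sym} {a : Sym}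
    {dir : Dir} :
    (copyCfg N o q t A B).next (.inr q')
      (moveBoth T.out N.inp (copyCfg N o q t A B).scan a dir) =
    copyCfg N o q' t (A.move dir) ((B.write a).move dir) := by
  refine Cfg.ext rfl (funext fun k => ?_)
  rcases k with k | k
  · by_cases hk : k = T.out
    · subst hk
      simp [copyCfg, Cfg.next, moveBoth, Cfg.scan, Action.apply]
    · simp [copyCfg, Cfg.next, moveBoth, Cfg.scan, Action.apply, hk]
  · by_cases hk : k = N.inp
    · subst hk
      simp [copyCfg, Cfg.next, moveBoth, Action.apply]
    · simp [copyCfg, Cfg.next, moveBoth, Cfg.scan, Action.apply, hk]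

theorem copyCfg_scan_inl {q : CopyPhase ⊕ N.Q} {t : T.K → Tape Sym} {A B : Tape Sym} :
    (copyCfg N o q t A B).scan (.inl T.out) = A.head := by
  simp [copyCfg, Cfg.scan]

theorem copyCfg_scan_inr {q : CopyPhase ⊕ N.Q} {t : T.K → Tape Sym} {A B : Tape Sym} :
    (copyCfg N o q t A B).scan (.inr N.inp) = B.head := by
  simp [copyCfg, Cfg.scan]

/-- Copying the word `w` and then going back over it.  The cells to the left of the word, `L` on the
tape of `N`, are arbitrary because the induction on `w` starts over after each copied bit. -/
theorem detReach_copy (t : T.K → Tape Sym) (w : Word) (A : Tape Sym) (hA : tapeWord A = w)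
    (L : ListBlank Sym) :
    (call T N o).DetReach (2 * w.length + 1)
      (copyCfg N o (.inl .copy) t A (Tape.mk' L (ListBlank.mk [])))
      (copyCfg N o (.inl .rewind) t (A.move .left)
        ((Tape.mk' L (ListBlank.mk (w.map some))).move .left)) := by
  induction w generalizing A L with
  | nil =>
    have hh := head_of_tapeWord_nil hA
    have := DetReach.of_δ (N := call T N o) (q := .inr (.inl .rewind))
      (c := copyCfg N o (.inl .copy) t A (Tape.mk' L (ListBlank.mk []))) rfl
      (if_pos (copyCfg_scan_inl.trans hh)) copyCfg_next
    rwa [ copyCfg_scan_inr, Tape.write_self] at this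
  | cons b w ih =>
    obtain ⟨hh, hw⟩ := head_of_tapeWord_cons hA
    have h₁ := DetReach.of_δ (N := call T N o) (q := .inr (.inl .copy))
      (c := copyCfg N o (.inl .copy) t A (Tape.mk' L (ListBlank.mk []))) rfl
      (if_neg (by rw [copyCfg_scan_inl, hh]; simp)) copyCfg_next
    rw [copyCfg_scan_inl, hh] at h₁
    have e₁ : (((Tape.mk' L (ListBlank.mk [])).write (some b)).move .right : Tape Sym) =
        Tape.mk' (L.cons (some b)) (ListBlank.mk []) := by simp
    rw [e₁] at h₁
    have h₂ := ih _ hw (L.cons (some b))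
    have e₂ : ((Tape.mk' (L.cons (some b)) (ListBlank.mk (w.map some))).move .left : Tape Sym) =
        Tape.mk' L (ListBlank.mk ((b :: w).map some)) := by simp
    rw [e₂, Tape.move_right_left] at h₂
    have h₃ := DetReach.of_δ (N := call T N o) (q := .inr (.inl .rewind))
      (c := copyCfg N o (.inl .rewind) t A (Tape.mk' L (ListBlank.mk ((b :: w).map some)))) rfl
      (if_neg (by rw [copyCfg_scan_inr]; simp)) copyCfg_next
    rw [copyCfg_scan_inr, Tape.write_self] at h₃
    have := (h₁.trans h₂).trans h₃
    rwa [show 1 + (2 * w.length + 1) + 1 = 2 * (b :: w).length + 1 by simp; ring] at this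

/-- After `T` has accepted with output `w`, the machine `N` is started on `w`. -/
theorem detReach_call {d : Cfg T.Q T.K} (hd : T.verdict d.state = some true) :
    (call T N o).DetReach (2 * (tapeWord (d.tape T.out)).length + 3)
      (fstCfg N o d) (sndCfg T o d.tape (N.init (tapeWord (d.tape T.out)))) := by
  have h₁ : (call T N o).DetReach 1 (fstCfg N o d)
      (copyCfg N o (.inl .copy) d.tape (d.tape T.out)
        (Tape.mk' (ListBlank.mk []) (ListBlank.mk []))) := by
    refine DetReach.of_δ (if_pos hd) (if_pos hd) ?_
    refine Cfg.ext rfl (funext fun k => ?_)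
    refine (apply_stay _).trans ?_
    rw [fstCfg_tape]
    rcases k with k | k
    · simp [copyCfg]
    · simp only [copyCfg, Sum.elim_inr]
      by_cases hk : k = N.inp
      · subst hk
        simp [blanks, Tape.mk₁, Tape.mk₂]
      · simp [hk, blanks]
  have h₂ := detReach_copy (N := N) (o := o) d.tape _ (d.tape T.out) rfl (ListBlank.mk [])
  have h₃ := DetReach.of_δ (N := call T N o) (q := .inr (.inr N.start))
    (c := copyCfg N o (.inl .rewind) d.tape ((d.tape T.out).move .left)
      ((Tape.mk' (ListBlank.mk []) (ListBlank.mk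
        ((tapeWord (d.tape T.out)).map some))).move .left)) rfl
    (if_pos (by rw [copyCfg_scan_inr]; simp; rfl)) copyCfg_next
  rw [copyCfg_scan_inr, Tape.write_self, Tape.move_left_right,
    Tape.move_left_right] at h₃
  have h₄ := (h₁.trans h₂).trans h₃
  have e₂ : copyCfg N o (.inr N.start) d.tape (d.tape T.out)
      (Tape.mk' (ListBlank.mk []) (ListBlank.mk ((tapeWord (d.tape T.out)).map some))) =
      sndCfg T o d.tape (N.init (tapeWord (d.tape T.out))) := by
    rw [sndCfg_eq]
    refine Cfg.ext rfl ?_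
    simp only [copyCfg, init, initial_tape, Function.update_eq_self]
    rfl
  rw [e₂] at h₄
  rwa [show 1 + (2 * (tapeWord (d.tape T.out)).length + 1) + 1 =
    2 * (tapeWord (d.tape T.out)).length + 3 by ring] at h₄

theorem call_init (x : Word) : (call T N o).init x = fstCfg N o (T.init x) := by
  refine Cfg.ext rfl ?_
  rw [fstCfg_tape]
  funext k
  rcases k with k | k
  · by_cases hk : k = T.inp
    · subst hk
      exact (if_pos rfl).trans (if_pos rfl).symm
    · exact (if_neg fun h => hk (Sum.inl_injective h)).trans (if_neg hk).symm
  · exact if_neg Sum.inr_ne_inl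

theorem verdict_fstCfg {d : Cfg T.Q T.K} (hd : T.verdict d.state ≠ some true) :
    (call T N o).verdict (fstCfg N o d).state = T.verdict d.state := if_neg hd

theorem call_acceptsAt {x : Word} {e : Cfg (call T N o).Q (call T N o).K} :
    (call T N o).AcceptsAt x e ↔ ∃ d, T.AcceptsAt x d ∧
      ∃ d', N.AcceptsAt (tapeWord (d.tape T.out)) d' ∧
        e = ⟨sndState T o d'.state, Sum.elim d.tape d'.tape⟩ := by
  rw [acceptsAt_iff, call_init, call_embeds_fst.accFrom_iff]
  constructor
  · rintro ⟨d, ⟨hp, hv⟩, ha⟩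
    by_cases hd : T.verdict d.state = some true
    · rw [(detReach_call hd).1, accFrom_sndCfg] at ha
      obtain ⟨d', ⟨hp', hv'⟩, ha'⟩ := ha
      replace ha' :=
        (accFrom_iff_of_ne_none (N := call T N o) (c := sndCfg T o d.tape d') hv').1 ha'
      exact ⟨d, ⟨hp, hd⟩, d', ⟨hp', ha'.2⟩, ha'.1.trans (sndCfg_eq _ _)⟩
    · rw [accFrom_iff_of_ne_none (by rwa [verdict_fstCfg hd]), verdict_fstCfg hd] at ha
      exact absurd ha.2 hd
  · rintro ⟨d, ⟨hp, hd⟩, d', ⟨hp', hd'⟩, rfl⟩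
    refine ⟨d, ⟨hp, by simp [hd]⟩, ?_⟩
    rw [(detReach_call hd).1, accFrom_sndCfg]
    refine ⟨d', ⟨hp', by simp [hd']⟩, ?_⟩
    have hv : (call T N o).verdict (sndCfg T o d.tape d').state = some true := hd'
    rw [accFrom_iff_of_ne_none (by simp [hv])]
    exact ⟨(sndCfg_eq _ _).symm, hv⟩

theorem call_polyTime (hT : T.PolyTime) (hN : N.PolyTime) : (call T N o).PolyTime := by
  obtain ⟨p, hp⟩ := polyTime_iff.1 hT
  obtain ⟨q, hq⟩ := polyTime_iff.1 hN
  -- `T` outputs a word of length at most `r.eval x.length`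
  let r : Polynomial ℕ := Polynomial.X + 1 + p
  refine ⟨p + (q.comp r + (2 * r + 3)), fun x => ?_⟩
  change (call T N o).TimeFrom _ _
  have hr : r.eval x.length = x.length + 1 + p.eval x.length := by simp [r]
  simp only [Polynomial.eval_add, Polynomial.eval_comp, Polynomial.eval_mul, Polynomial.eval_ofNat]
  rw [call_init]
  refine call_embeds_fst.timeFrom (hp x) fun d hd => ?_
  by_cases hacc : T.verdict d.state = some true
  · have hlen := hd.length_tapeWord_le (hp x) T.out
    rw [← hr] at hlen
    refine TimeFrom.mono ((detReach_call hacc).2 (q.eval (tapeWord (d.tape T.out)).length) ?_) ?_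
    · exact call_embeds_snd.timeFrom (B' := 0) (hq _) fun d' hd' => timeFrom_zero hd'.2
    · have := eval_monotone q hlen
      dsimp only at this
      omega
  · refine (timeFrom_zero ?_).mono (Nat.zero_le _)
    rw [verdict_fstCfg hacc]
    exact hd.2

theorem call_accepts {x : Word} :
    (call T N o).Accepts x ↔ ∃ y, T.Outputs x y ∧ N.Accepts y := by
  simp only [Accepts, call_acceptsAt, Outputs]
  constructor
  · rintro ⟨e, d, hd, d', hd', -⟩
    exact ⟨_, ⟨d, hd, rfl⟩, d', hd'⟩
  · rintro ⟨_, ⟨d, hd, rfl⟩, d', hd'⟩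
    exact ⟨_, d, hd, d', hd', rfl⟩

/-- With the output tape of `T` as the output tape, a call of `N` is a test of the output. -/
theorem call_outputs {x y : Word} :
    (call T N (.inl T.out)).Outputs x y ↔ T.Outputs x y ∧ N.Accepts y := by
  simp only [Accepts, call_acceptsAt, Outputs]
  constructor
  · rintro ⟨e, ⟨d, hd, d', hd', rfl⟩, rfl⟩
    exact ⟨⟨d, hd, rfl⟩, d', hd'⟩
  · rintro ⟨⟨d, hd, rfl⟩, d', hd'⟩
    exact ⟨_, ⟨d, hd, d', hd', rfl⟩, rfl⟩

end Call

end NTM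

/-! ### Nondeterministic choice between two machines -/

namespace NTM

/-- The tapes of `N₂` among those of `union N₁ N₂`: both machines use the same input tape. -/
def unionTape (N₁ N₂ : NTM) [DecidableEq N₂.K] (k : N₂.K) : N₁.K ⊕ N₂.K :=
  if k = N₂.inp then .inl N₁.inp else .inr k

open Classical in
/-- The machine that chooses one of `N₁` and `N₂` and runs it. -/
noncomputable def union (N₁ N₂ : NTM) : NTM where
  Q := Option (N₁.Q ⊕ N₂.Q)
  K := N₁.K ⊕ N₂.K
  start := none
  inp := .inl N₁.inp
  out := .inl N₁.inp
  verdict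
    | none => none
    | some (.inl q) => N₁.verdict q
    | some (.inr q) => N₂.verdict q
  δ
    | none, scan => {(some (.inl N₁.start), fun k => (scan k, none)),
        (some (.inr N₂.start), fun k => (scan k, none))}
    | some (.inl q), scan =>
      (fun m => (some (.inl m.1), liftAct .inl scan m.2)) '' N₁.δ q (scan ∘ .inl)
    | some (.inr q), scan =>
      (fun m => (some (.inr m.1), liftAct (unionTape N₁ N₂) scan m.2)) ''
        N₂.δ q (scan ∘ unionTape N₁ N₂)

section Union

variable {N₁ N₂ : NTM}

variable (N₁ N₂) in
/-- The states of `union N₁ N₂` in which `N₁` is running. -/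
def unionFst (q : N₁.Q) : (union N₁ N₂).Q := some (.inl q)

variable (N₁ N₂) in
/-- The states of `union N₁ N₂` in which `N₂` is running. -/
def unionSnd (q : N₂.Q) : (union N₁ N₂).Q := some (.inr q)

theorem union_embeds_fst : Embeds N₁ (union N₁ N₂) (unionFst N₁ N₂) Sum.inl where
  injective := Sum.inl_injective
  verdict _ hq := hq
  δ _ _ _ := rfl

open Classical in
theorem unionTape_injective : Function.Injective (unionTape N₁ N₂) := by
  intro k k' h
  by_cases h₁ : k = N₂.inp <;> by_cases h₂ : k' = N₂.inp
  · exact h₁.trans h₂.symm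
  · rw [unionTape, unionTape, if_pos h₁, if_neg h₂] at h
    exact absurd h Sum.inl_ne_inr
  · rw [unionTape, unionTape, if_neg h₁, if_pos h₂] at h
    exact absurd h Sum.inr_ne_inl
  · rw [unionTape, unionTape, if_neg h₁, if_neg h₂] at h
    exact Sum.inr_injective h

open Classical in
theorem union_embeds_snd : Embeds N₂ (union N₁ N₂) (unionSnd N₁ N₂) (unionTape N₁ N₂) where
  injective := unionTape_injective
  verdict _ hq := hq
  δ _ _ _ := rfl

open Classical in
theorem union_step_init {x : Word} {e : Cfg (union N₁ N₂).Q (union N₁ N₂).K} :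
    (union N₁ N₂).Step ((union N₁ N₂).init x) e ↔
      e = liftCfg (unionFst N₁ N₂) (Sum.inl : N₁.K → (union N₁ N₂).K) (blanks _) (N₁.init x) ∨
      e = liftCfg (unionSnd N₁ N₂) (unionTape N₁ N₂ : N₂.K → (union N₁ N₂).K) (blanks _)
        (N₂.init x) := by
  have h₁ : liftCfg (unionFst N₁ N₂) (Sum.inl : N₁.K → (union N₁ N₂).K) (blanks _) (N₁.init x) =
      ⟨some (.inl N₁.start), ((union N₁ N₂).init x).tape⟩ := by
    refine Cfg.ext rfl (funext fun k => ?_)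
    rcases k with k | k
    · refine (Sum.inl_injective.extend_apply _ _ k).trans ?_
      by_cases hk : k = N₁.inp
      · exact (if_pos hk).trans (if_pos (congrArg Sum.inl hk)).symm
      · exact (if_neg hk).trans (if_neg fun h => hk (Sum.inl_injective h)).symm
    · exact (Function.extend_apply' _ _ _ (by simp)).trans (if_neg Sum.inr_ne_inl).symm
  have h₂ : liftCfg (unionSnd N₁ N₂) (unionTape N₁ N₂ : N₂.K → (union N₁ N₂).K) (blanks _)
      (N₂.init x) = ⟨some (.inr N₂.start), ((union N₁ N₂).init x).tape⟩ := by
    refine Cfg.ext rfl (funext fun k => ?_)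
    by_cases hk : ∃ i, unionTape N₁ N₂ i = k
    · obtain ⟨i, rfl⟩ := hk
      refine (unionTape_injective.extend_apply _ _ i).trans ?_
      by_cases hi : i = N₂.inp
      · exact (if_pos hi).trans (if_pos (if_pos hi)).symm
      · refine (if_neg hi).trans (if_neg fun h => ?_).symm
        exact Sum.inr_ne_inl ((if_neg hi).symm.trans h)
    · refine (Function.extend_apply' _ _ _ hk).trans (if_neg fun h => hk ⟨N₂.inp, ?_⟩).symm
      exact (if_pos rfl).trans h.symm
  have hnext : ∀ q, ((union N₁ N₂).init x).next q
      (fun k => (((union N₁ N₂).init x).scan k, none)) = ⟨q, ((union N₁ N₂).init x).tape⟩ :=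
    fun q => Cfg.ext rfl (funext fun k => apply_stay _)
  rw [h₁, h₂]
  constructor
  · rintro ⟨-, m, hm | hm, rfl⟩
    · rw [hm]
      exact .inl (hnext _)
    · rw [hm]
      exact .inr (hnext _)
  · rintro (rfl | rfl)
    · exact ⟨rfl, _, .inl rfl, (hnext _).symm⟩
    · exact ⟨rfl, _, .inr rfl, (hnext _).symm⟩

/-- A part that takes its verdicts over to the whole machine accepts on the part's terms. -/
theorem Embeds.accepts_iff {N M : NTM} {s : N.Q → M.Q} {j : N.K → M.K} (h : Embeds N M s j)
    (hv : ∀ q, M.verdict (s q) = N.verdict q) {t : M.K → Tape Sym} {x : Word} :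
    (∃ e, M.AccFrom (liftCfg s j t (N.init x)) e) ↔ N.Accepts x := by
  constructor
  · rintro ⟨e, he⟩
    obtain ⟨d', ⟨hp, hd⟩, ha⟩ := h.accFrom_iff.1 he
    have hd' : M.verdict (liftCfg s j t d').state = N.verdict d'.state := hv _
    rw [accFrom_iff_of_ne_none (by rwa [hd']), hd'] at ha
    exact ⟨d', hp, ha.2⟩
  · rintro ⟨d', hp, hd⟩
    have hd' : M.verdict (liftCfg s j t d').state = some true := (hv _).trans hd
    exact ⟨_, h.accFrom_iff.2 ⟨d', ⟨hp, by simp [hd]⟩, ⟨0, .refl _⟩, hd'⟩⟩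

theorem union_accepts {x : Word} : (union N₁ N₂).Accepts x ↔ N₁.Accepts x ∨ N₂.Accepts x := by
  classical
  rw [← (union_embeds_fst (N₁ := N₁) (N₂ := N₂)).accepts_iff (fun _ => rfl) (t := blanks _),
    ← (union_embeds_snd (N₁ := N₁) (N₂ := N₂)).accepts_iff (fun _ => rfl) (t := blanks _),
    ← exists_or]
  refine exists_congr fun e => ?_
  rw [acceptsAt_iff, accFrom_iff_of_none rfl]
  constructor
  · rintro ⟨d, hd, ha⟩
    obtain rfl | rfl := union_step_init.1 hd
    · exact .inl ha
    · exact .inr ha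
  · rintro (ha | ha)
    · exact ⟨_, union_step_init.2 (.inl rfl), ha⟩
    · exact ⟨_, union_step_init.2 (.inr rfl), ha⟩

theorem union_polyTime (h₁ : N₁.PolyTime) (h₂ : N₂.PolyTime) : (union N₁ N₂).PolyTime := by
  classical
  obtain ⟨p, hp⟩ := polyTime_iff.1 h₁
  obtain ⟨q, hq⟩ := polyTime_iff.1 h₂
  refine ⟨p + q + 1, fun x => ?_⟩
  change (union N₁ N₂).TimeFrom _ _
  simp only [Polynomial.eval_add, Polynomial.eval_one]
  refine timeFrom_succ fun d hd => ?_
  obtain rfl | rfl := union_step_init.1 hd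
  · exact (union_embeds_fst.timeFrom (B' := 0) (hp x) fun d' hd' => timeFrom_zero hd'.2).mono
      (by omega)
  · exact (union_embeds_snd.timeFrom (B' := 0) (hq x) fun d' hd' => timeFrom_zero hd'.2).mono
      (by omega)

end Union

/-! ### Machines with one tape -/

/-- The machine that accepts at once, and whose output is its input. -/
def echo : NTM where
  Q := Unit
  K := Unit
  start := ()
  inp := ()
  out := ()
  verdict _ := some true
  δ _ _ := ∅

theorem echo_outputs {x y : Word} : echo.Outputs x y ↔ y = x := by
  have hx : tapeWord ((echo.init x).tape echo.out) = x :=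
    (congrArg _ (if_pos rfl)).trans (tapeWord_mk₁ x)
  simp only [Outputs, acceptsAt_iff, accFrom_iff_of_ne_none (N := echo) (c := echo.init x)
    (Option.some_ne_none true)]
  constructor
  · rintro ⟨_, ⟨rfl, -⟩, rfl⟩
    exact hx
  · rintro rfl
    exact ⟨_, ⟨rfl, rfl⟩, hx⟩

theorem echo_polyTime : echo.PolyTime :=
  ⟨0, fun _ _ _ h => (timeFrom_zero (N := echo) (Option.some_ne_none true) _ _ h).trans
    (Nat.zero_le _)⟩

/-- States for the machines that read or write two bits. -/
inductive BitState where
  | start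
  | fst (b : Bool)
  | snd (b : Bool)
  | done

instance : Finite BitState :=
  Finite.of_surjective (fun
      | none => BitState.start
      | some none => .done
      | some (some (b, true)) => .fst b
      | some (some (b, false)) => .snd b : Option (Option (Bool × Bool)) → BitState) fun
    | .start => ⟨none, rfl⟩
    | .done => ⟨some none, rfl⟩
    | .fst b => ⟨some (some (b, true)), rfl⟩
    | .snd b => ⟨some (some (b, false)), rfl⟩

/-- The machine that removes the first two bits of its input if they satisfy `P`, and has no
accepting path otherwise. -/
def dropTwo (P : Bool → Bool → Prop) : NTM where
  Q := BitState
  K := Unit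
  start := .start
  inp := ()
  out := ()
  verdict
    | .done => some true
    | _ => none
  δ
    | .start, scan => {m | ∃ c, scan () = some c ∧ m = (.fst c, fun _ => (some c, some .right))}
    | .fst c, scan =>
      {m | ∃ d, scan () = some d ∧ P c d ∧ m = (.done, fun _ => (some d, some .right))}
    | _, _ => ∅

/-- The machine that guesses a bit `b` and writes `b` and `!b` in front of its input. -/
def guessBit : NTM where
  Q := BitState
  K := Unit
  start := .start
  inp := ()
  out := ()
  verdict
    | .done => some true
    | _ => none
  δ
    | .start, scan => {m | ∃ b, m = (.fst b, fun _ => (scan (), some .left))}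
    | .fst b, _ => {(.snd b, fun _ => (some !b, some .left))}
    | .snd b, _ => {(.done, fun _ => (some b, none))}
    | _, _ => ∅

section OneTape

variable {P : Bool → Bool → Prop}

theorem initial_unit {Q : Type} (q : Q) (x : Word) :
    Cfg.initial q () x = ⟨q, fun _ => Tape.mk₁ (x.map some)⟩ :=
  Cfg.ext rfl (funext fun _ => if_pos rfl)

theorem dropTwo_step_start {T : Tape Sym} {e : Cfg (dropTwo P).Q (dropTwo P).K} :
    (dropTwo P).Step ⟨.start, fun _ => T⟩ e ↔
      ∃ c, T.head = some c ∧ e = ⟨.fst c, fun _ => T.move .right⟩ := by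
  constructor
  · rintro ⟨-, m, ⟨c, hc, rfl⟩, rfl⟩
    refine ⟨c, hc, Cfg.ext rfl (funext fun _ => ?_)⟩
    change (T.write (some c)).move .right = _
    rw [← show T.head = some c from hc, Tape.write_self]
  · rintro ⟨c, hc, rfl⟩
    refine ⟨rfl, _, ⟨c, hc, rfl⟩, Cfg.ext rfl (funext fun _ => ?_)⟩
    change _ = (T.write (some c)).move .right
    rw [← hc, Tape.write_self]

theorem dropTwo_step_fst {T : Tape Sym} {c : Bool} {e : Cfg (dropTwo P).Q (dropTwo P).K} :
    (dropTwo P).Step ⟨.fst c, fun _ => T⟩ e ↔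
      ∃ d, T.head = some d ∧ P c d ∧ e = ⟨.done, fun _ => T.move .right⟩ := by
  constructor
  · rintro ⟨-, m, ⟨d, hd, hP, rfl⟩, rfl⟩
    refine ⟨d, hd, hP, Cfg.ext rfl (funext fun _ => ?_)⟩
    change (T.write (some d)).move .right = _
    rw [← show T.head = some d from hd, Tape.write_self]
  · rintro ⟨d, hd, hP, rfl⟩
    refine ⟨rfl, _, ⟨d, hd, hP, rfl⟩, Cfg.ext rfl (funext fun _ => ?_)⟩
    change _ = (T.write (some d)).move .right
    rw [← hd, Tape.write_self]

theorem dropTwo_outputs {w y : Word} :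
    (dropTwo P).Outputs w y ↔ ∃ c d, w = c :: d :: y ∧ P c d := by
  have key : ∀ e, (dropTwo P).AcceptsAt w e ↔ ∃ c d u, w = c :: d :: u ∧ P c d ∧
      e = ⟨.done, fun _ => Tape.mk' (ListBlank.mk [some d, some c])
        (ListBlank.mk (u.map some))⟩ := by
    intro e
    rw [acceptsAt_iff, accFrom_iff_of_none rfl]
    have h₁ : (dropTwo P).init w = ⟨.start, fun _ => Tape.mk₁ (w.map some)⟩ := initial_unit _ _
    have h₂ : ∀ c T, (dropTwo P).AccFrom ⟨.fst c, fun _ => T⟩ e ↔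
        ∃ d, T.head = some d ∧ P c d ∧ e = ⟨.done, fun _ => T.move .right⟩ := by
      intro c T
      rw [accFrom_iff_of_none rfl]
      constructor
      · rintro ⟨e', hs, ha⟩
        obtain ⟨d, hd, hP, rfl⟩ := dropTwo_step_fst.1 hs
        exact ⟨d, hd, hP, ((accFrom_iff_of_ne_none (by exact Option.some_ne_none true)).1 ha).1⟩
      · rintro ⟨d, hd, hP, rfl⟩
        exact ⟨_, dropTwo_step_fst.2 ⟨d, hd, hP, rfl⟩, ⟨0, .refl _⟩, rfl⟩
    rw [h₁]
    constructor
    · rintro ⟨e', hs, ha⟩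
      obtain ⟨c, hc, rfl⟩ := dropTwo_step_start.1 hs
      obtain ⟨d, hd, hP, rfl⟩ := (h₂ _ _).1 ha
      rcases w with - | ⟨c', - | ⟨d', u⟩⟩
      · cases hc
      · cases hd
      · obtain rfl : c' = c := Option.some_injective _ hc
        obtain rfl : d' = d := Option.some_injective _ hd
        exact ⟨c', d', u, rfl, hP, rfl⟩
    · rintro ⟨c, d, u, rfl, hP, rfl⟩
      exact ⟨_, dropTwo_step_start.2 ⟨c, rfl, rfl⟩, (h₂ _ _).2 ⟨d, rfl, hP, rfl⟩⟩
  constructor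
  · rintro ⟨e, he, rfl⟩
    obtain ⟨c, d, u, rfl, hP, rfl⟩ := (key e).1 he
    refine ⟨c, d, ?_, hP⟩
    simp
  · rintro ⟨c, d, rfl, hP⟩
    refine ⟨_, (key _).2 ⟨c, d, y, rfl, hP, rfl⟩, ?_⟩
    simp

theorem dropTwo_polyTime : (dropTwo P).PolyTime := by
  refine ⟨2, fun x => ?_⟩
  change (dropTwo P).TimeFrom _ _
  rw [Polynomial.eval_ofNat]
  refine timeFrom_succ fun d hd => timeFrom_succ fun e he => ?_
  obtain ⟨c, -, rfl⟩ := dropTwo_step_start.1 hd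
  obtain ⟨c, -, -, rfl⟩ := dropTwo_step_fst.1 he
  exact timeFrom_zero (Option.some_ne_none true)

theorem guessBit_step_init {x : Word} {e : Cfg guessBit.Q guessBit.K} :
    guessBit.Step (guessBit.init x) e ↔
      ∃ b, e = ⟨.fst b, fun _ => (Tape.mk₁ (x.map some)).move .left⟩ := by
  rw [show guessBit.init x = ⟨.start, fun _ => Tape.mk₁ (x.map some)⟩ from initial_unit _ _]
  constructor
  · rintro ⟨-, m, ⟨b, rfl⟩, rfl⟩
    exact ⟨b, rfl⟩
  · rintro ⟨b, rfl⟩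
    exact ⟨rfl, _, ⟨b, rfl⟩, rfl⟩

theorem guessBit_detReach (b : Bool) (x : Word) :
    guessBit.DetReach 2 ⟨.fst b, fun _ => (Tape.mk₁ (x.map some)).move .left⟩
      ⟨.done, fun _ => Tape.mk₁ ((b :: (!b) :: x).map some)⟩ := by
  have h₁ : guessBit.DetReach 1 ⟨.fst b, fun _ => (Tape.mk₁ (x.map some)).move .left⟩
      ⟨.snd b, fun _ => (((Tape.mk₁ (x.map some)).move .left).write (some !b)).move .left⟩ :=
    .of_δ rfl rfl rfl
  -- the new scanned cell is blank
  have h₂ : (((Tape.mk₁ (x.map some)).move .left).write (some !b)).move .left =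
      (Tape.mk₁ ((b :: (!b) :: x).map some)).write none := by
    simp only [Tape.mk₁, Tape.mk₂]
    simp
    rfl
  rw [h₂] at h₁
  exact h₁.trans (.of_δ rfl rfl rfl)

theorem guessBit_outputs {x y : Word} :
    guessBit.Outputs x y ↔ ∃ b, y = b :: (!b) :: x := by
  have key : ∀ e, guessBit.AcceptsAt x e ↔
      ∃ b, e = ⟨.done, fun _ => Tape.mk₁ ((b :: (!b) :: x).map some)⟩ := by
    intro e
    rw [acceptsAt_iff, accFrom_iff_of_none rfl]
    constructor
    · rintro ⟨e', hs, ha⟩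
      obtain ⟨b, rfl⟩ := guessBit_step_init.1 hs
      rw [(guessBit_detReach b x).1] at ha
      exact ⟨b, ((accFrom_iff_of_ne_none (by exact Option.some_ne_none true)).1 ha).1⟩
    · rintro ⟨b, rfl⟩
      exact ⟨_, guessBit_step_init.2 ⟨b, rfl⟩,
        ((guessBit_detReach b x).1 _).2 ⟨⟨0, .refl _⟩, rfl⟩⟩
  constructor
  · rintro ⟨e, he, rfl⟩
    obtain ⟨b, rfl⟩ := (key e).1 he
    exact ⟨b, tapeWord_mk₁ _⟩
  · rintro ⟨b, rfl⟩
    exact ⟨_, (key _).2 ⟨b, rfl⟩, tapeWord_mk₁ _⟩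

theorem guessBit_polyTime : guessBit.PolyTime := by
  refine ⟨3, fun x => ?_⟩
  change guessBit.TimeFrom _ _
  rw [Polynomial.eval_ofNat]
  refine timeFrom_succ (B := 0 + 2) fun d hd => ?_
  obtain ⟨b, rfl⟩ := guessBit_step_init.1 hd
  exact (guessBit_detReach b x).2 _ (timeFrom_zero (Option.some_ne_none true))

end OneTape

end NTM

/-! ### Closure properties of `NP` -/

/-- Preimages under the multivalued functions computed by nondeterministic machines. -/
theorem preimage_mem_NP {N : NTM} (hN : N.PolyTime) {B : Set Word} (hB : B ∈ NP) :
    {x | ∃ y, N.Outputs x y ∧ y ∈ B} ∈ NP := by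
  obtain ⟨N', hN', h⟩ := hB
  refine ⟨.call N N' (.inl N.out), NTM.call_polyTime hN hN', fun x => ?_⟩
  simp [NTM.call_accepts, h]

theorem inter_mem_NP {A B : Set Word} (hA : A ∈ NP) (hB : B ∈ NP) : A ∩ B ∈ NP := by
  obtain ⟨N, hN, h⟩ := hA
  -- `A ∩ B` is the preimage of `B` under the identity restricted to `A`
  have := preimage_mem_NP (NTM.call_polyTime (o := .inl NTM.echo.out) NTM.echo_polyTime hN) hB
  convert this using 1
  ext x
  simp [NTM.call_outputs, NTM.echo_outputs, h]

theorem union_mem_NP {A B : Set Word} (hA : A ∈ NP) (hB : B ∈ NP) : A ∪ B ∈ NP := by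
  obtain ⟨N₁, hN₁, h₁⟩ := hA
  obtain ⟨N₂, hN₂, h₂⟩ := hB
  refine ⟨.union N₁ N₂, NTM.union_polyTime hN₁ hN₂, fun x => ?_⟩
  simp [NTM.union_accepts, h₁, h₂]

theorem univ_mem_NP : Set.univ ∈ NP := by
  refine ⟨.echo, NTM.echo_polyTime, fun x => ?_⟩
  obtain ⟨c, hc, -⟩ := NTM.echo_outputs.2 (rfl : x = x)
  exact iff_of_true trivial ⟨c, hc⟩

/-- Words whose first two bits satisfy `P` and are followed by an element of `B`. -/
theorem twoBits_mem_NP (P : Bool → Bool → Prop) {B : Set Word} (hB : B ∈ NP) :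
    {w | ∃ c d y, w = c :: d :: y ∧ P c d ∧ y ∈ B} ∈ NP := by
  convert preimage_mem_NP (NTM.dropTwo_polyTime (P := P)) hB using 1
  ext w
  simp only [NTM.dropTwo_outputs, Set.mem_ofPred_eq]
  constructor
  · rintro ⟨c, d, y, rfl, hP, hy⟩
    exact ⟨y, ⟨c, d, rfl, hP⟩, hy⟩
  · rintro ⟨y, ⟨c, d, rfl, hP⟩, hy⟩
    exact ⟨c, d, y, rfl, hP, hy⟩

/-! ### The reducibility -/

/-- The symmetric differences of a set in `NP ∩ coNP` and a set in `NP`. -/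
def XorClass : Set (Set Word) := {L | ∃ A ∈ NP ∩ coNP, ∃ B ∈ NP, L = symmDiff A B}

/-- The truth table `α x` is the exclusive or of the constant `α x false` and of
`t ↦ (α x false ≠ α x true) ∧ t`. -/
theorem RSN1tt_NP_subset_xorClass : RSN1tt NP ⊆ XorClass := by
  rintro L ⟨B, hB, y, α, ⟨N, hN, hf⟩, hL⟩
  have hout : ∀ x w, N.Outputs x w ↔ w = encodeTT (α x) (y x) :=
    fun x w => ⟨(hf x).2 w, fun h => h ▸ (hf x).1⟩
  have hpre : ∀ V ∈ NP, {x | encodeTT (α x) (y x) ∈ V} ∈ NP := by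
    intro V hV
    convert preimage_mem_NP hN hV using 1
    ext x
    simp [hout]
  refine ⟨{x | α x false = true}, ⟨?_, ?_⟩, {x | α x false ≠ α x true ∧ y x ∈ B}, ?_, ?_⟩
  · convert hpre _ (twoBits_mem_NP (fun c _ => c = true) univ_mem_NP) using 1
    ext x
    cases h : α x true <;> simp [encodeTT, h]
  · change {x | α x false = true}ᶜ ∈ NP
    convert hpre _ (twoBits_mem_NP (fun c _ => c = false) univ_mem_NP) using 1
    ext x
    cases h : α x true <;> simp [encodeTT, h]
  · convert hpre _ (twoBits_mem_NP (fun c d => c ≠ d) hB) using 1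
    ext x
    cases h₀ : α x false <;> cases h₁ : α x true <;> simp [encodeTT, h₀, h₁]
  · ext x
    rw [hL, Set.mem_symmDiff]
    by_cases hy : y x ∈ B <;> cases h₀ : α x false <;> cases h₁ : α x true <;>
      simp [chi, hy, h₀, h₁]

theorem xorClass_subset_RSN1tt_NP : XorClass ⊆ RSN1tt NP := by
  rintro L ⟨A, ⟨hA, hA'⟩, B, hB, rfl⟩
  -- the strings `b, !b, x` for which `b` is the answer to `x ∈ A`
  have hV := union_mem_NP (twoBits_mem_NP (fun c d => c = true ∧ d = false) hA)
    (twoBits_mem_NP (fun c d => c = false ∧ d = true) hA')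
  obtain ⟨N, hN, h⟩ := hV
  refine ⟨B, hB, id, fun x b => xor (chi A x) b, ⟨.call .guessBit N (.inl NTM.guessBit.out),
    NTM.call_polyTime NTM.guessBit_polyTime hN, fun x => ?_⟩, fun x => ?_⟩
  · have key : ∀ y, (NTM.call .guessBit N (.inl NTM.guessBit.out)).Outputs x y ↔
        y = encodeTT (fun b => xor (chi A x) b) (id x) := by
      intro y
      rw [NTM.call_outputs, NTM.guessBit_outputs, ← h]
      by_cases hx : x ∈ A <;> simp [encodeTT, chi, hx]
      · constructor
        · rintro ⟨rfl | rfl, h⟩ <;> simp_all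
        · rintro rfl
          simp [hx]
      · constructor
        · rintro ⟨rfl | rfl, h⟩ <;> simp_all
        · rintro rfl
          simp [hx]
    simp [key]
  · by_cases hx : x ∈ A <;> simp [Set.mem_symmDiff, chi, hx]

/-! ### Oracle machines with fixed answers -/

/-- The instruction asks the first oracle. -/
def Instr.AsksFst {Q K : Type} : Instr Q K → Prop
  | .askFst _ => True
  | .askBoth _ => True
  | _ => False

/-- The instruction asks the second oracle. -/
def Instr.AsksSnd {Q K : Type} : Instr Q K → Prop
  | .askSnd _ => True
  | .askBoth _ => True
  | _ => False

/-- The oracle that gives the answer `a` to all queries. -/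
def constOracle (a : Bool) : Set Word := {_w | a = true}

@[simp] theorem chi_constOracle (a : Bool) (w : Word) : chi (constOracle a) w = a := by
  cases a <;> simp [chi, constOracle]

theorem chi_congr {A A' : Set Word} {w : Word} (h : w ∈ A ↔ w ∈ A') : chi A w = chi A' w := by
  simp [chi, h]

namespace OTM

variable {M : OTM}

theorem run_succ (A B : Set Word) (x : Word) (n : ℕ) :
    M.run A B x (n + 1) = M.step A B (M.run A B x n) := Function.iterate_succ_apply' _ _ _

theorem run_add_of_halt {A B : Set Word} {x : Word} {n : ℕ} {r : Bool}
    (h : M.instr (M.run A B x n).state = .halt r) (k : ℕ) :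
    M.run A B x (n + k) = M.run A B x n := by
  induction k with
  | zero => rfl
  | succ k ih => rw [← Nat.add_assoc, run_succ, ih, step, h]

theorem run_eq_of_halt {A B : Set Word} {x : Word} {m n : ℕ} {r : Bool}
    (h : M.instr (M.run A B x n).state = .halt r) (hmn : n ≤ m) :
    M.run A B x m = M.run A B x n := by
  obtain ⟨k, rfl⟩ := Nat.exists_eq_add_of_le hmn
  exact run_add_of_halt h k

theorem halt_unique {A B : Set Word} {x : Word} {m n : ℕ} {r s : Bool}
    (h : M.instr (M.run A B x n).state = .halt r)
    (h' : M.instr (M.run A B x m).state = .halt s) : r = s := by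
  rcases le_total n m with hmn | hmn
  · rw [run_eq_of_halt h hmn, h] at h'
    exact Instr.halt.inj h'
  · rw [run_eq_of_halt h' hmn, h'] at h
    exact (Instr.halt.inj h).symm

/-- The computation of `M` in which the oracle answers are fixed to be `a` and `b`, as a
nondeterministic machine with verdicts `v` and output tape `o`.  It is used with verdicts that halt
wherever `M` does, and possibly earlier. -/
def fixAnswers (M : OTM) (a b : Bool) (v : M.Q → Option Bool) (o : M.K) : NTM where
  Q := M.Q
  K := M.K
  start := M.start
  inp := M.inp
  out := o
  verdict := v
  δ q scan :=
    match M.instr q with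
    | .compute δ => {δ scan}
    | .askFst next => {(next a, fun k => (scan k, none))}
    | .askSnd next => {(next b, fun k => (scan k, none))}
    | .askBoth next => {(next a b, fun k => (scan k, none))}
    | .halt _ => ∅

section FixAnswers

variable {a b : Bool} {v : M.Q → Option Bool} {o : M.K}

theorem next_stay (c : Cfg M.Q M.K) (q : M.Q) :
    c.next q (fun k => (c.scan k, none)) = ⟨q, c.tape⟩ :=
  Cfg.ext rfl (funext fun _ => apply_stay _)

theorem fixAnswers_step (hv : ∀ q r, M.instr q = .halt r → v q ≠ none) {c d : Cfg M.Q M.K} :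
    (M.fixAnswers a b v o).Step c d ↔
      v c.state = none ∧ d = M.step (constOracle a) (constOracle b) c := by
  refine and_congr_right fun hc => ?_
  have hδ : ∀ q act, (M.fixAnswers a b v o).δ c.state c.scan = {(q, act)} →
      ((∃ m ∈ (M.fixAnswers a b v o).δ c.state c.scan, d = c.next m.1 m.2) ↔ d = c.next q act) := by
    intro q act h
    rw [h]
    constructor
    · rintro ⟨m, rfl, h⟩
      exact h
    · rintro h
      exact ⟨_, rfl, h⟩
  unfold step
  cases h : M.instr c.state with
  | compute δ => exact hδ _ _ (by simp [fixAnswers, h]; rfl)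
  | askFst next =>
    refine (hδ (next a) _ (by simp [fixAnswers, h]; rfl)).trans ?_
    rw [next_stay]
    simp
  | askSnd next =>
    refine (hδ (next b) _ (by simp [fixAnswers, h]; rfl)).trans ?_
    rw [next_stay]
    simp
  | askBoth next =>
    refine (hδ (next a b) _ (by simp [fixAnswers, h]; rfl)).trans ?_
    rw [next_stay]
    simp
  | halt r => exact absurd hc (hv _ _ h)

theorem fixAnswers_path (hv : ∀ q r, M.instr q = .halt r → v q ≠ none) {n : ℕ}
    {c d : Cfg M.Q M.K} :
    (M.fixAnswers a b v o).Path n c d ↔ d = (M.step (constOracle a) (constOracle b))^[n] c ∧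
      ∀ i < n, v ((M.step (constOracle a) (constOracle b))^[i] c).state = none := by
  induction n generalizing c with
  | zero =>
    constructor
    · intro h
      exact ⟨NTM.path_zero_iff.1 h, by simp⟩
    · rintro ⟨rfl, -⟩
      exact .refl _
  | succ n ih =>
    constructor
    · intro h
      obtain ⟨d', hs, hp⟩ := NTM.path_succ_iff.1 h
      obtain ⟨hc, rfl⟩ := (fixAnswers_step hv).1 hs
      obtain ⟨rfl, hi⟩ := ih.1 hp
      refine ⟨rfl, fun i hin => ?_⟩
      cases i with
      | zero => exact hc
      | succ i => exact hi i (by omega)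
    · rintro ⟨rfl, hi⟩
      exact .head ((fixAnswers_step hv).2 ⟨hi 0 (by omega), rfl⟩)
        (ih.2 ⟨rfl, fun i hin => hi (i + 1) (by omega)⟩)

theorem fixAnswers_acceptsAt (hv : ∀ q r, M.instr q = .halt r → v q ≠ none) {x : Word}
    {e : Cfg M.Q M.K} :
    (M.fixAnswers a b v o).AcceptsAt x e ↔
      ∃ n, e = M.run (constOracle a) (constOracle b) x n ∧ v e.state = some true ∧
        ∀ i < n, v (M.run (constOracle a) (constOracle b) x i).state = none := by
  constructor
  · rintro ⟨⟨n, hn⟩, he⟩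
    obtain ⟨h, hi⟩ := (fixAnswers_path hv).1 hn
    exact ⟨n, h, he, hi⟩
  · rintro ⟨n, h, he, hi⟩
    exact ⟨⟨n, (fixAnswers_path hv).2 ⟨h, hi⟩⟩, he⟩

theorem fixAnswers_polyTime (hM : M.PolyTime) (hv : ∀ q r, M.instr q = .halt r → v q ≠ none) :
    (M.fixAnswers a b v o).PolyTime := by
  obtain ⟨p, hp⟩ := hM
  refine ⟨p, fun x n c h => ?_⟩
  obtain ⟨-, hi⟩ := (fixAnswers_path hv).1 h
  by_contra! hlt
  obtain ⟨r, hr⟩ := hp (constOracle a) (constOracle b) x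
  exact hv _ _ hr (hi _ hlt)

end FixAnswers

open Classical in
/-- The verdicts that stop the computation with the verdict `s` in the states of `S`, and otherwise
turn the final answer `r` of the machine into the verdict `h r`. -/
noncomputable def stopAt (M : OTM) (S : Set M.Q) (s : Bool) (h : Bool → Bool) (q : M.Q) :
    Option Bool :=
  if q ∈ S then some s else
    match M.instr q with
    | .halt r => some (h r)
    | _ => none

theorem stopAt_ne_none {S : Set M.Q} {s : Bool} {h : Bool → Bool} (q : M.Q) (r : Bool)
    (hq : M.instr q = .halt r) : M.stopAt S s h q ≠ none := by
  unfold stopAt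
  split <;> simp [hq]

theorem stopAt_eq_none {S : Set M.Q} {s : Bool} {h : Bool → Bool} {q : M.Q} (hS : q ∉ S)
    (hq : ∀ r, M.instr q ≠ .halt r) : M.stopAt S s h q = none := by
  rw [stopAt, if_neg hS]
  split
  · exact absurd ‹_› (hq _)
  · rfl

/-- With fixed answers `a` and `b`, the machine is in a state of `S` for the first time after `n`
steps. -/
def FirstAt (M : OTM) (S : Set M.Q) (a b : Bool) (x : Word) (n : ℕ) : Prop :=
  (M.run (constOracle a) (constOracle b) x n).state ∈ S ∧
    ∀ i < n, (M.run (constOracle a) (constOracle b) x i).state ∉ S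

theorem FirstAt.unique {S : Set M.Q} {a b : Bool} {x : Word} {m n : ℕ} (hm : M.FirstAt S a b x m)
    (hn : M.FirstAt S a b x n) : m = n := by
  rcases lt_trichotomy m n with h | h | h
  · exact absurd hm.1 (hn.2 m h)
  · exact h
  · exact absurd hn.1 (hm.2 n h)

/-- The inputs on which the word on tape `o` at the first visit to `S` belongs to `V`, the oracle
answers being fixed. -/
def firstIn (M : OTM) (S : Set M.Q) (o : M.K) (V : Set Word) (a b : Bool) : Set Word :=
  {x | ∃ n, M.FirstAt S a b x n ∧
    tapeWord ((M.run (constOracle a) (constOracle b) x n).tape o) ∈ V}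

/-- The inputs on which the machine with fixed oracle answers halts with the answer `r`. -/
def haltsWith (M : OTM) (r a b : Bool) : Set Word :=
  {x | ∃ n, M.instr (M.run (constOracle a) (constOracle b) x n).state = .halt r}

theorem firstIn_mem_NP (hM : M.PolyTime) {S : Set M.Q} (hS : ∀ q ∈ S, ∀ r, M.instr q ≠ .halt r)
    {o : M.K} {V : Set Word} (hV : V ∈ NP) (a b : Bool) : M.firstIn S o V a b ∈ NP := by
  convert preimage_mem_NP (fixAnswers_polyTime (a := a) (b := b) (o := o) hM
    (stopAt_ne_none (S := S) (s := true) (h := fun _ => false))) hV using 1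
  ext x
  constructor
  · rintro ⟨n, ⟨hn, hi⟩, hw⟩
    refine ⟨_, ⟨_, (fixAnswers_acceptsAt stopAt_ne_none).2 ⟨n, rfl, if_pos hn, fun i hin => ?_⟩,
      rfl⟩, hw⟩
    refine stopAt_eq_none (hi i hin) fun r hr => ?_
    rw [run_eq_of_halt hr hin.le] at hn
    exact hS _ hn _ hr
  · rintro ⟨_, ⟨e, he, rfl⟩, hw⟩
    obtain ⟨n, rfl, hn, hi⟩ := (fixAnswers_acceptsAt stopAt_ne_none).1 he
    refine ⟨n, ⟨?_, fun i hin hmem => ?_⟩, hw⟩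
    · by_contra hmem
      rw [stopAt, if_neg hmem] at hn
      split at hn <;> simp at hn
    · have := hi i hin
      simp [stopAt, hmem] at this

theorem exists_first_halt (hM : M.PolyTime) (A B : Set Word) (x : Word) :
    ∃ n r, M.instr (M.run A B x n).state = .halt r ∧
      ∀ i < n, ∀ s, M.instr (M.run A B x i).state ≠ .halt s := by
  classical
  obtain ⟨p, hp⟩ := hM
  have h : ∃ n, ∃ r, M.instr (M.run A B x n).state = .halt r := ⟨_, hp A B x⟩
  obtain ⟨r, hr⟩ := Nat.find_spec h
  exact ⟨_, r, hr, fun i hi s hs => Nat.find_min h hi ⟨s, hs⟩⟩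

theorem never_mem_NP (hM : M.PolyTime) (S : Set M.Q) (a b : Bool) :
    {x | ∀ n, (M.run (constOracle a) (constOracle b) x n).state ∉ S} ∈ NP := by
  refine ⟨M.fixAnswers a b (M.stopAt S false fun _ => true) M.inp,
    fixAnswers_polyTime hM stopAt_ne_none, fun x => ?_⟩
  constructor
  · intro hx
    obtain ⟨n, r, hr, hi⟩ := exists_first_halt hM (constOracle a) (constOracle b) x
    refine ⟨_, (fixAnswers_acceptsAt stopAt_ne_none).2 ⟨n, rfl, ?_, fun i hin => ?_⟩⟩
    · simp [stopAt, hx n, hr]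
    · exact stopAt_eq_none (hx i) (hi i hin)
  · rintro ⟨e, he⟩ m hm
    obtain ⟨n, rfl, hn, hi⟩ := (fixAnswers_acceptsAt stopAt_ne_none).1 he
    have hnS : (M.run (constOracle a) (constOracle b) x n).state ∉ S := by
      intro h
      simp [stopAt, h] at hn
    rcases lt_or_ge m n with hmn | hmn
    · have := hi m hmn
      simp [stopAt, hm] at this
    · cases hq : M.instr (M.run (constOracle a) (constOracle b) x n).state with
      | halt r =>
        rw [run_eq_of_halt hq hmn] at hm
        exact hnS hm
      | _ => simp [stopAt, hnS, hq] at hn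

theorem haltsWith_mem_NP (hM : M.PolyTime) (r a b : Bool) : M.haltsWith r a b ∈ NP := by
  refine ⟨M.fixAnswers a b (M.stopAt ∅ false fun s => s == r) M.inp,
    fixAnswers_polyTime hM stopAt_ne_none, fun x => ?_⟩
  constructor
  · rintro ⟨m, hm⟩
    obtain ⟨n, s, hs, hi⟩ := exists_first_halt hM (constOracle a) (constOracle b) x
    obtain rfl := halt_unique hs hm
    refine ⟨_, (fixAnswers_acceptsAt stopAt_ne_none).2 ⟨n, rfl, ?_, fun i hin => ?_⟩⟩
    · simp [stopAt, hs]
    · exact stopAt_eq_none (Set.notMem_empty _) (hi i hin)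
  · rintro ⟨e, he⟩
    obtain ⟨n, rfl, hn, -⟩ := (fixAnswers_acceptsAt stopAt_ne_none).1 he
    refine ⟨n, ?_⟩
    cases hq : M.instr (M.run (constOracle a) (constOracle b) x n).state with
    | halt s =>
      simp [stopAt, hq] at hn
      rw [hn]
    | _ => simp [stopAt, hq] at hn

theorem notMem_haltsWith_true_iff (hM : M.PolyTime) {x : Word} {a b : Bool} :
    x ∉ M.haltsWith true a b ↔ x ∈ M.haltsWith false a b := by
  obtain ⟨n, r, hr, -⟩ := exists_first_halt hM (constOracle a) (constOracle b) x
  constructor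
  · intro h
    cases r with
    | false => exact ⟨n, hr⟩
    | true => exact absurd ⟨n, hr⟩ h
  · rintro ⟨m, hm⟩ ⟨n, hn⟩
    exact absurd (halt_unique hm hn) (by simp)

/-! ### One query to each oracle -/

/-- The states in which the first oracle is asked. -/
def fstStates (M : OTM) : Set M.Q := {q | (M.instr q).AsksFst}

/-- The states in which the second oracle is asked. -/
def sndStates (M : OTM) : Set M.Q := {q | (M.instr q).AsksSnd}

theorem not_halt_of_mem_fstStates (q : M.Q) (hq : q ∈ M.fstStates) (r : Bool) :
    M.instr q ≠ .halt r := by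
  intro h
  simp [fstStates, h, Instr.AsksFst] at hq

theorem not_halt_of_mem_sndStates (q : M.Q) (hq : q ∈ M.sndStates) (r : Bool) :
    M.instr q ≠ .halt r := by
  intro h
  simp [sndStates, h, Instr.AsksSnd] at hq

/-- Each oracle is asked at most once, in whatever order. -/
def OneQueryEach (M : OTM) (A B : Set Word) : Prop :=
  ∀ x i j, i < j →
    ¬ ((M.run A B x i).state ∈ M.fstStates ∧ (M.run A B x j).state ∈ M.fstStates) ∧
    ¬ ((M.run A B x i).state ∈ M.sndStates ∧ (M.run A B x j).state ∈ M.sndStates)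

theorem step_congr {A B A' B' : Set Word} {c : Cfg M.Q M.K}
    (h₁ : c.state ∈ M.fstStates →
      (tapeWord (c.tape M.qryFst) ∈ A ↔ tapeWord (c.tape M.qryFst) ∈ A'))
    (h₂ : c.state ∈ M.sndStates →
      (tapeWord (c.tape M.qrySnd) ∈ B ↔ tapeWord (c.tape M.qrySnd) ∈ B')) :
    M.step A B c = M.step A' B' c := by
  unfold step
  cases h : M.instr c.state with
  | compute δ => rfl
  | askFst next =>
    simp only
    rw [chi_congr (h₁ (by simp [fstStates, h, Instr.AsksFst]))]
  | askSnd next =>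
    simp only
    rw [chi_congr (h₂ (by simp [sndStates, h, Instr.AsksSnd]))]
  | askBoth next =>
    simp only
    rw [chi_congr (h₁ (by simp [fstStates, h, Instr.AsksFst])),
      chi_congr (h₂ (by simp [sndStates, h, Instr.AsksSnd]))]
  | halt r => rfl

/-- Two oracle computations coincide as long as the answers do. -/
theorem run_congr {A B A' B' : Set Word} {x : Word} {n : ℕ}
    (h₁ : ∀ i < n, (M.run A B x i).state ∈ M.fstStates →
      (tapeWord ((M.run A B x i).tape M.qryFst) ∈ A ↔
        tapeWord ((M.run A B x i).tape M.qryFst) ∈ A'))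
    (h₂ : ∀ i < n, (M.run A B x i).state ∈ M.sndStates →
      (tapeWord ((M.run A B x i).tape M.qrySnd) ∈ B ↔
        tapeWord ((M.run A B x i).tape M.qrySnd) ∈ B')) :
    M.run A B x n = M.run A' B' x n := by
  induction n with
  | zero => rfl
  | succ n ih =>
    rw [run_succ, run_succ, ← ih (fun i hi => h₁ i (by omega)) (fun i hi => h₂ i (by omega))]
    exact step_congr (h₁ n (by omega)) (h₂ n (by omega))

/-- The inputs on which the first query to the first oracle gets a positive answer from `A` when
all answers of the second oracle are `b`.  The answers of the first oracle before that query do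
not matter, as there are none. -/
def fstYes (M : OTM) (A : Set Word) (b : Bool) : Set Word :=
  M.firstIn M.fstStates M.qryFst A false b

/-- The inputs that are accepted when all answers of the second oracle are `b`, and those of the
first oracle are the one that `A` gives to the first query. -/
def acceptedWith (M : OTM) (A : Set Word) (b : Bool) : Set Word :=
  {x | x ∈ M.haltsWith true (chi (M.fstYes A b) x) b}

/-- The inputs on which the query to the second oracle gets a positive answer from `B`.  This query
is found by giving the right answer to the first oracle's query, if it comes earlier; the second
oracle's answer `false` has no influence on it. -/
def sndYes (M : OTM) (A B : Set Word) : Set Word :=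
  {x | x ∈ M.firstIn M.sndStates M.qrySnd B (chi (M.fstYes A false) x) false}

/-- If the queries to `B` in the first `n` steps have the answer `b`, then these steps are those of
the computation with fixed answers in which the first oracle answers as `A` does on the first query
of the computation with all second answers `b`. -/
theorem run_eq_of_snd_answer {A B : Set Word} (h : M.OneQueryEach A B) {x : Word} {b : Bool} {n : ℕ}
    (hb : ∀ i < n, (M.run A B x i).state ∈ M.sndStates →
      (tapeWord ((M.run A B x i).tape M.qrySnd) ∈ B ↔ b = true)) :
    M.run A B x n = M.run (constOracle (chi (M.fstYes A b) x)) (constOracle b) x n := by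
  refine run_congr (fun i hi hmem => ?_) hb
  -- the computation up to the only query to `A`, which takes place after `i` steps
  have hno : ∀ j < i, (M.run A B x j).state ∉ M.fstStates :=
    fun j hj hmem' => (h x j i hj).1 ⟨hmem', hmem⟩
  have heq : ∀ j ≤ i, M.run A B x j = M.run (constOracle false) (constOracle b) x j :=
    fun j hj => run_congr (fun l hl hmem' => absurd hmem' (hno l (by omega)))
      fun l hl => hb l (by omega)
  have hfirst : M.FirstAt M.fstStates false b x i :=
    ⟨heq i le_rfl ▸ hmem, fun j hj => heq j hj.le ▸ hno j hj⟩
  have hyes : x ∈ M.fstYes A b ↔ tapeWord ((M.run A B x i).tape M.qryFst) ∈ A := by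
    rw [heq i le_rfl]
    constructor
    · rintro ⟨n, hn, hw⟩
      rwa [hn.unique hfirst] at hw
    · exact fun hw => ⟨i, hfirst, hw⟩
  rw [← hyes]
  simp [constOracle, chi]

theorem accepts_iff_of_snd_answer {A B : Set Word} (h : M.OneQueryEach A B) {x : Word} {b : Bool}
    (hb : ∀ i, (M.run A B x i).state ∈ M.sndStates →
      (tapeWord ((M.run A B x i).tape M.qrySnd) ∈ B ↔ b = true)) :
    M.Accepts A B x ↔ x ∈ M.acceptedWith A b :=
  exists_congr fun _ => by rw [run_eq_of_snd_answer h fun i _ => hb i]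

theorem accepts_iff_of_mem_sndYes {A B : Set Word} (h : M.OneQueryEach A B) {x : Word}
    (hx : x ∈ M.sndYes A B) : M.Accepts A B x ↔ x ∈ M.acceptedWith A true := by
  obtain ⟨n, ⟨hn, hfirst⟩, hw⟩ := hx
  -- the query found with the fixed answers is the one made with the oracles `A` and `B`
  have heq : ∀ i ≤ n, M.run A B x i =
      M.run (constOracle (chi (M.fstYes A false) x)) (constOracle false) x i := by
    intro i
    induction i using Nat.strong_induction_on with | _ i ih =>
    intro hi
    refine run_eq_of_snd_answer h fun j hj hmem => absurd hmem ?_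
    rw [ih j hj (by omega)]
    exact hfirst j (by omega)
  rw [← heq n le_rfl] at hn hw
  refine accepts_iff_of_snd_answer h fun i hi => ?_
  obtain rfl : i = n := by
    rcases lt_trichotomy i n with hlt | heq | hlt
    · exact absurd ⟨hi, hn⟩ (h x i n hlt).2
    · exact heq
    · exact absurd ⟨hn, hi⟩ (h x n i hlt).2
  exact iff_of_true hw rfl

theorem accepts_iff_of_notMem_sndYes {A B : Set Word} (h : M.OneQueryEach A B) {x : Word}
    (hx : x ∉ M.sndYes A B) : M.Accepts A B x ↔ x ∈ M.acceptedWith A false := by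
  refine accepts_iff_of_snd_answer h fun i hi => iff_of_false (fun hw => hx ?_) (by simp)
  have hno : ∀ j < i, (M.run A B x j).state ∉ M.sndStates :=
    fun j hj hmem => (h x j i hj).2 ⟨hmem, hi⟩
  have heq : ∀ j ≤ i, M.run A B x j =
      M.run (constOracle (chi (M.fstYes A false) x)) (constOracle false) x j :=
    fun j hj => run_eq_of_snd_answer h fun l hl hmem => absurd hmem (hno l (by omega))
  rw [heq i le_rfl] at hi hw
  exact ⟨i, ⟨hi, fun j hj => heq j hj.le ▸ hno j hj⟩, hw⟩

theorem fstYes_mem_NP (hM : M.PolyTime) {A : Set Word} (hA : A ∈ NP) (b : Bool) :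
    M.fstYes A b ∈ NP := firstIn_mem_NP hM not_halt_of_mem_fstStates hA _ _

theorem compl_fstYes_mem_NP (hM : M.PolyTime) {A : Set Word} (hA : A ∈ coNP) (b : Bool) :
    (M.fstYes A b)ᶜ ∈ NP := by
  classical
  convert union_mem_NP (never_mem_NP hM M.fstStates false b)
    (firstIn_mem_NP (o := M.qryFst) hM not_halt_of_mem_fstStates hA false b) using 1
  ext x
  constructor
  · intro hx
    by_cases hex : ∃ n, (M.run (constOracle false) (constOracle b) x n).state ∈ M.fstStates
    · have hfirst : M.FirstAt M.fstStates false b x (Nat.find hex) :=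
        ⟨Nat.find_spec hex, fun i hi => Nat.find_min hex hi⟩
      exact .inr ⟨_, hfirst, fun hw => hx ⟨_, hfirst, hw⟩⟩
    · exact .inl fun n hn => hex ⟨n, hn⟩
  · rintro (hx | ⟨n, hn, hw⟩) ⟨m, hm, hw'⟩
    · exact hx m hm.1
    · rw [hn.unique hm] at hw
      exact hw hw'

/-- A case distinction by a set in `NP ∩ coNP`. -/
theorem ite_mem_NP {Y : Set Word} (hY : Y ∈ NP) (hY' : Yᶜ ∈ NP) {D : Bool → Set Word}
    (hD : ∀ a, D a ∈ NP) : {x | x ∈ D (chi Y x)} ∈ NP := by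
  convert union_mem_NP (inter_mem_NP hY (hD true)) (inter_mem_NP hY' (hD false)) using 1
  ext x
  by_cases hx : x ∈ Y <;> simp [chi, hx]

theorem acceptedWith_mem_NP (hM : M.PolyTime) {A : Set Word} (hA : A ∈ NP ∩ coNP) (b : Bool) :
    M.acceptedWith A b ∈ NP :=
  ite_mem_NP (fstYes_mem_NP hM hA.1 b) (compl_fstYes_mem_NP hM hA.2 b)
    fun a => haltsWith_mem_NP hM true a b

theorem compl_acceptedWith_mem_NP (hM : M.PolyTime) {A : Set Word} (hA : A ∈ NP ∩ coNP)
    (b : Bool) : (M.acceptedWith A b)ᶜ ∈ NP := by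
  convert ite_mem_NP (fstYes_mem_NP hM hA.1 b) (compl_fstYes_mem_NP hM hA.2 b)
    fun a => haltsWith_mem_NP hM false a b using 1
  ext x
  exact notMem_haltsWith_true_iff hM

theorem sndYes_mem_NP (hM : M.PolyTime) {A B : Set Word} (hA : A ∈ NP ∩ coNP) (hB : B ∈ NP) :
    M.sndYes A B ∈ NP :=
  ite_mem_NP (fstYes_mem_NP hM hA.1 false) (compl_fstYes_mem_NP hM hA.2 false)
    fun a => firstIn_mem_NP hM not_halt_of_mem_sndStates hB a false

/-- The accepted set differs from the set accepted with the second answer `false` on those inputs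
for which the second answer is `true` and matters. -/
theorem accepted_mem_xorClass (hM : M.PolyTime) {A B : Set Word} (h : M.OneQueryEach A B)
    (hA : A ∈ NP ∩ coNP) (hB : B ∈ NP) : {x | M.Accepts A B x} ∈ XorClass := by
  have hpos := acceptedWith_mem_NP hM hA
  have hneg := compl_acceptedWith_mem_NP hM hA
  refine ⟨M.acceptedWith A false, ⟨hpos _, hneg _⟩,
    M.sndYes A B ∩ (M.acceptedWith A false ∩ (M.acceptedWith A true)ᶜ ∪
      (M.acceptedWith A false)ᶜ ∩ M.acceptedWith A true),
    inter_mem_NP (sndYes_mem_NP hM hA hB)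
      (union_mem_NP (inter_mem_NP (hpos _) (hneg _)) (inter_mem_NP (hneg _) (hpos _))), ?_⟩
  ext x
  by_cases hx : x ∈ M.sndYes A B
  · have := accepts_iff_of_mem_sndYes h hx
    simp only [Set.mem_symmDiff, Set.mem_ofPred_eq, Set.mem_inter_iff, Set.mem_union,
      Set.mem_compl_iff]
    tauto
  · have := accepts_iff_of_notMem_sndYes h hx
    simp only [Set.mem_symmDiff, Set.mem_ofPred_eq, Set.mem_inter_iff]
    tauto

end OTM

/-! ### The order of the queries -/

/-- The instruction with the two oracles exchanged. -/
def Instr.swap {Q K : Type} : Instr Q K → Instr Q K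
  | .compute δ => .compute δ
  | .askFst next => .askSnd next
  | .askSnd next => .askFst next
  | .askBoth next => .askBoth fun a b => next b a
  | .halt r => .halt r

theorem Instr.swap_eq_halt {Q K : Type} {i : Instr Q K} {r : Bool} :
    i.swap = .halt r ↔ i = .halt r := by
  cases i <;> simp [Instr.swap]

namespace OTM

/-- The machine with the two oracles exchanged. -/
def swap (M : OTM) : OTM where
  Q := M.Q
  K := M.K
  start := M.start
  inp := M.inp
  qryFst := M.qrySnd
  qrySnd := M.qryFst
  instr q := (M.instr q).swap

variable {M : OTM}

theorem swap_step (A B : Set Word) (c : Cfg M.Q M.K) : M.swap.step B A c = M.step A B c := by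
  have hi : M.swap.instr c.state = (M.instr c.state).swap := rfl
  unfold step
  rw [hi]
  cases M.instr c.state <;> rfl

theorem swap_run (A B : Set Word) (x : Word) (n : ℕ) : M.swap.run B A x n = M.run A B x n :=
  congrFun (congrArg (fun f : Cfg M.Q M.K → Cfg M.Q M.K => f^[n]) (funext (swap_step A B))) _

theorem swap_instr_eq_halt {q : M.Q} {r : Bool} :
    M.swap.instr q = .halt r ↔ M.instr q = .halt r := Instr.swap_eq_halt

theorem swap_polyTime (h : M.PolyTime) : M.swap.PolyTime := by
  obtain ⟨p, hp⟩ := h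
  refine ⟨p, fun A B x => ?_⟩
  obtain ⟨r, hr⟩ := hp B A x
  refine ⟨r, swap_instr_eq_halt.2 ?_⟩
  rwa [swap_run]

theorem swap_accepts {A B : Set Word} {x : Word} : M.swap.Accepts B A x ↔ M.Accepts A B x :=
  exists_congr fun n => by
    refine swap_instr_eq_halt.trans ?_
    rw [swap_run]

theorem mem_swap_fstStates {q : M.Q} : q ∈ M.swap.fstStates ↔ q ∈ M.sndStates := by
  change (M.instr q).swap.AsksFst ↔ (M.instr q).AsksSnd
  cases M.instr q <;> rfl

theorem mem_swap_sndStates {q : M.Q} : q ∈ M.swap.sndStates ↔ q ∈ M.fstStates := by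
  change (M.instr q).swap.AsksSnd ↔ (M.instr q).AsksFst
  cases M.instr q <;> rfl

theorem OneQueryEach.swap {A B : Set Word} (h : M.OneQueryEach A B) :
    M.swap.OneQueryEach B A := by
  intro x i j hij
  rw [swap_run, swap_run]
  refine ⟨?_, ?_⟩
  · rintro ⟨hi, hj⟩
    exact (h x i j hij).2 ⟨mem_swap_fstStates.1 hi, mem_swap_fstStates.1 hj⟩
  · rintro ⟨hi, hj⟩
    exact (h x i j hij).1 ⟨mem_swap_sndStates.1 hi, mem_swap_sndStates.1 hj⟩

/-- Queries made after `i` and `j` steps appear in this order among the queries. -/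
theorem sublist_queries {A B : Set Word} {x : Word} {i j : ℕ} (hij : i < j) {s t : Query}
    (hs : (M.instr (M.run A B x i).state).query = some s)
    (ht : (M.instr (M.run A B x j).state).query = some t) :
    [s, t].Sublist (M.queries A B x (j + 1)) := by
  have h : [i, j].Sublist (List.range (j + 1)) := by
    rw [List.range_succ]
    exact (List.singleton_sublist.2 (List.mem_range.2 hij)).append (List.Sublist.refl [j])
  have := h.filterMap fun i => (M.instr (M.run A B x i).state).query
  simp only [List.filterMap_cons, hs, ht, List.filterMap_nil] at this
  exact this

theorem query_of_mem_fstStates {q : M.Q} (h : q ∈ M.fstStates) :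
    (M.instr q).query = some .fst ∨ (M.instr q).query = some .both := by
  change (M.instr q).AsksFst at h
  cases hq : M.instr q <;> simp_all [Instr.AsksFst, Instr.query]

theorem query_of_mem_sndStates {q : M.Q} (h : q ∈ M.sndStates) :
    (M.instr q).query = some .snd ∨ (M.instr q).query = some .both := by
  change (M.instr q).AsksSnd at h
  cases hq : M.instr q <;> simp_all [Instr.AsksSnd, Instr.query]

theorem SequentialQueries.oneQueryEach {A B : Set Word} (h : M.SequentialQueries A B) :
    M.OneQueryEach A B := by
  intro x i j hij
  constructor <;> rintro ⟨hi, hj⟩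
  · rcases query_of_mem_fstStates hi with hi | hi <;>
      rcases query_of_mem_fstStates hj with hj | hj <;>
      simpa using ((sublist_queries hij hi hj).trans (h x (j + 1))).eq_of_length rfl
  · rcases query_of_mem_sndStates hi with hi | hi <;>
      rcases query_of_mem_sndStates hj with hj | hj <;>
      simpa using ((sublist_queries hij hi hj).trans (h x (j + 1))).eq_of_length rfl

theorem ParallelQueries.oneQueryEach {A B : Set Word} (h : M.ParallelQueries A B) :
    M.OneQueryEach A B := by
  intro x i j hij
  have key : ∀ s t, (M.instr (M.run A B x i).state).query = some s →
      (M.instr (M.run A B x j).state).query ≠ some t := by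
    intro s t hs ht
    have := ((sublist_queries hij hs ht).trans (h x (j + 1))).length_le
    simp at this
  constructor <;> rintro ⟨hi, hj⟩
  · rcases query_of_mem_fstStates hi with hi | hi <;>
      rcases query_of_mem_fstStates hj with hj | hj <;> exact key _ _ hi hj
  · rcases query_of_mem_sndStates hi with hi | hi <;>
      rcases query_of_mem_sndStates hj with hj | hj <;> exact key _ _ hi hj

end OTM

theorem PSeq_subset_xorClass : PSeq (NP ∩ coNP) NP ⊆ XorClass := by
  rintro L ⟨A, hA, B, hB, M, hM, hq, hL⟩
  rw [show L = {x | M.Accepts A B x} from Set.ext hL]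
  exact OTM.accepted_mem_xorClass hM hq.oneQueryEach hA hB

theorem PSeq_swap_subset_xorClass : PSeq NP (NP ∩ coNP) ⊆ XorClass := by
  rintro L ⟨A, hA, B, hB, M, hM, hq, hL⟩
  rw [show L = {x | M.swap.Accepts B A x} from Set.ext fun x => (hL x).trans OTM.swap_accepts.symm]
  exact OTM.accepted_mem_xorClass (OTM.swap_polyTime hM) hq.oneQueryEach.swap hB hA

theorem PPar_subset_xorClass : PPar (NP ∩ coNP) NP ⊆ XorClass := by
  rintro L ⟨A, hA, B, hB, M, hM, hq, hL⟩
  rw [show L = {x | M.Accepts A B x} from Set.ext hL]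
  exact OTM.accepted_mem_xorClass hM hq.oneQueryEach hA hB

/-! ### Symmetric differences by two queries -/

/-- States of the machines that ask both oracles about the input. -/
inductive AskState where
  | start
  | second (a : Bool)
  | done (r : Bool)

instance : Finite AskState :=
  Finite.of_surjective (fun
      | none => AskState.start
      | some (b, true) => .second b
      | some (b, false) => .done b : Option (Bool × Bool) → AskState) fun
    | .start => ⟨none, rfl⟩
    | .second b => ⟨some (b, true), rfl⟩
    | .done b => ⟨some (b, false), rfl⟩

/-- The machine that asks both oracles about its input, one after the other, and accepts if the
answers differ. -/
def xorSeq : OTM where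
  Q := AskState
  K := Unit
  start := .start
  inp := ()
  qryFst := ()
  qrySnd := ()
  instr
    | .start => .askFst .second
    | .second a => .askSnd fun b => .done (xor a b)
    | .done r => .halt r

/-- The machine that asks both oracles about its input at the same time, and accepts if the
answers differ. -/
def xorPar : OTM where
  Q := AskState
  K := Unit
  start := .start
  inp := ()
  qryFst := ()
  qrySnd := ()
  instr
    | .done r => .halt r
    | _ => .askBoth fun a b => .done (xor a b)

theorem xor_chi_iff {A B : Set Word} {x : Word} :
    x ∈ symmDiff A B ↔ xor (chi A x) (chi B x) = true := by
  by_cases hA : x ∈ A <;> by_cases hB : x ∈ B <;> simp [Set.mem_symmDiff, chi, hA, hB]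

theorem symmDiff_mem_PSeq {C D : Set (Set Word)} {A B : Set Word} (hA : A ∈ C) (hB : B ∈ D) :
    symmDiff A B ∈ PSeq C D := by
  have hinit : ∀ x, xorSeq.init x = ⟨.start, fun _ => Tape.mk₁ (x.map some)⟩ :=
    fun x => NTM.initial_unit _ _
  have h₀ : ∀ A B x, xorSeq.run A B x 0 = ⟨.start, fun _ => Tape.mk₁ (x.map some)⟩ :=
    fun A B x => hinit x
  have h₁ : ∀ A B x, xorSeq.run A B x 1 = ⟨.second (chi A x), fun _ => Tape.mk₁ (x.map some)⟩ := by
    intro A B x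
    rw [OTM.run_succ, h₀]
    exact Cfg.ext (congrArg (fun w => AskState.second (chi A w)) (tapeWord_mk₁ x)) rfl
  have h₂ : ∀ A B x, xorSeq.run A B x 2 =
      ⟨.done (xor (chi A x) (chi B x)), fun _ => Tape.mk₁ (x.map some)⟩ := by
    intro A B x
    rw [OTM.run_succ, h₁]
    exact Cfg.ext (congrArg (fun w => AskState.done (xor (chi A x) (chi B w))) (tapeWord_mk₁ x)) rfl
  have hhalt : ∀ A B x, xorSeq.instr (xorSeq.run A B x 2).state =
      .halt (xor (chi A x) (chi B x)) := by
    intro A B x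
    rw [h₂]
    rfl
  refine ⟨A, hA, B, hB, xorSeq, ⟨2, fun A B x => ⟨xor (chi A x) (chi B x), ?_⟩⟩,
    fun x n => ?_, fun x => ?_⟩
  · rw [Polynomial.eval_ofNat]
    exact hhalt A B x
  · have q₀ : (xorSeq.instr (xorSeq.run A B x 0).state).query = some .fst := by
      rw [h₀]
      rfl
    have q₁ : (xorSeq.instr (xorSeq.run A B x 1).state).query = some .snd := by
      rw [h₁]
      rfl
    rcases n with - | - | n
    · exact List.nil_sublist _
    · simp [OTM.queries, List.range_succ, q₀]
    · have : xorSeq.queries A B x (n + 2) = [.fst, .snd] := by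
        induction n with
        | zero => simp [OTM.queries, List.range_succ, q₀, q₁]
        | succ n ih =>
          have hn : (xorSeq.instr (xorSeq.run A B x (n + 2)).state).query = none := by
            rw [OTM.run_eq_of_halt (hhalt A B x) (by omega), hhalt]
            rfl
          rw [OTM.queries] at ih ⊢
          rw [show n + 1 + 2 = n + 2 + 1 by ring, List.range_succ, List.filterMap_append, ih]
          simp [hn]
      rw [this]
  · rw [xor_chi_iff]
    constructor
    · intro h
      exact ⟨2, by rw [hhalt, h]⟩
    · rintro ⟨n, hn⟩
      exact OTM.halt_unique (hhalt A B x) hn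

theorem symmDiff_mem_PPar {C D : Set (Set Word)} {A B : Set Word} (hA : A ∈ C) (hB : B ∈ D) :
    symmDiff A B ∈ PPar C D := by
  have hinit : ∀ x, xorPar.init x = ⟨.start, fun _ => Tape.mk₁ (x.map some)⟩ :=
    fun x => NTM.initial_unit _ _
  have h₀ : ∀ A B x, xorPar.run A B x 0 = ⟨.start, fun _ => Tape.mk₁ (x.map some)⟩ :=
    fun A B x => hinit x
  have h₁ : ∀ A B x, xorPar.run A B x 1 =
      ⟨.done (xor (chi A x) (chi B x)), fun _ => Tape.mk₁ (x.map some)⟩ := by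
    intro A B x
    rw [OTM.run_succ, h₀]
    exact Cfg.ext (congrArg (fun w => AskState.done (xor (chi A w) (chi B w))) (tapeWord_mk₁ x)) rfl
  have hhalt : ∀ A B x, xorPar.instr (xorPar.run A B x 1).state =
      .halt (xor (chi A x) (chi B x)) := by
    intro A B x
    rw [h₁]
    rfl
  refine ⟨A, hA, B, hB, xorPar, ⟨1, fun A B x => ⟨xor (chi A x) (chi B x), ?_⟩⟩,
    fun x n => ?_, fun x => ?_⟩
  · rw [Polynomial.eval_one]
    exact hhalt A B x
  · have q₀ : (xorPar.instr (xorPar.run A B x 0).state).query = some .both := by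
      rw [h₀]
      rfl
    rcases n with - | n
    · exact List.nil_sublist _
    · have : xorPar.queries A B x (n + 1) = [.both] := by
        induction n with
        | zero => simp [OTM.queries, List.range_succ, q₀]
        | succ n ih =>
          have hn : (xorPar.instr (xorPar.run A B x (n + 1)).state).query = none := by
            rw [OTM.run_eq_of_halt (hhalt A B x) (by omega), hhalt]
            rfl
          rw [OTM.queries] at ih ⊢
          rw [List.range_succ, List.filterMap_append, ih]
          simp [hn]
      rw [this]
  · rw [xor_chi_iff]
    constructor
    · intro h
      exact ⟨1, by rw [hhalt, h]⟩
    · rintro ⟨n, hn⟩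
      exact OTM.halt_unique (hhalt A B x) hn

theorem RSN1tt_NP_eq_xorClass : RSN1tt NP = XorClass :=
  RSN1tt_NP_subset_xorClass.antisymm xorClass_subset_RSN1tt_NP

theorem PSeq_eq_xorClass : PSeq (NP ∩ coNP) NP = XorClass := by
  refine PSeq_subset_xorClass.antisymm ?_
  rintro L ⟨A, hA, B, hB, rfl⟩
  exact symmDiff_mem_PSeq hA hB

theorem PSeq_swap_eq_xorClass : PSeq NP (NP ∩ coNP) = XorClass := by
  refine PSeq_swap_subset_xorClass.antisymm ?_
  rintro L ⟨A, hA, B, hB, rfl⟩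
  rw [symmDiff_comm]
  exact symmDiff_mem_PSeq hB hA

theorem PPar_eq_xorClass : PPar (NP ∩ coNP) NP = XorClass := by
  refine PPar_subset_xorClass.antisymm ?_
  rintro L ⟨A, hA, B, hB, rfl⟩
  exact symmDiff_mem_PPar hA hB

end SNQuery

theorem corollaryc :
    SNQuery.RSN1tt SNQuery.NP = SNQuery.PSeq (SNQuery.NP ∩ SNQuery.coNP) SNQuery.NP ∧
    SNQuery.PSeq (SNQuery.NP ∩ SNQuery.coNP) SNQuery.NP =
      SNQuery.PSeq SNQuery.NP (SNQuery.NP ∩ SNQuery.coNP) ∧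
    SNQuery.PSeq SNQuery.NP (SNQuery.NP ∩ SNQuery.coNP) =
      SNQuery.PPar (SNQuery.NP ∩ SNQuery.coNP) SNQuery.NP := by
  rw [SNQuery.RSN1tt_NP_eq_xorClass, SNQuery.PSeq_eq_xorClass, SNQuery.PSeq_swap_eq_xorClass,
    SNQuery.PPar_eq_xorClass]
  exact ⟨rfl, rfl, rfl⟩
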